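/- **Definitions.** An *orthogonal factorization system* $(A_-,A_+)$ on a category $A$ consists of two classes of morphisms, each containing the isomorphisms and closed under composition, such that every morphism is a morphism of $A_-$ followed by one of $A_+$, and the morphisms of $A_-$ have the unique left lifting property against those of $A_+$. A *generalized Reedy category* is an essentially small category $A$ with a function $\deg:\mathrm{Ob}\,A\to\mathbb N$ that respects isomorphisms and an orthogonal factorization system $(A_-,A_+)$ such that every non-isomorphism of $A_-$ strictly lowers and every non-isomorphism of $A_+$ strictly raises degree. It is *Eilenberg–Zilber* if every pair of morphisms of $A_-$ with common domain has an absolute pushout in $A$ (one preserved by every functor out of $A$). A *pseudo-section* of $p:a\to b$ is a morphism $i:c\to a$ with $pi$ an isomorphism; $p:a\to b$ and $p':a\to b'$ are *pseudo-equal* if $p'=\varphi p$ for an isomorphism $\varphi:b\to b'$. A generalized Reedy category is *strongly skeletal* if every morphism of $A_-$ is a split epimorphism and any two morphisms of $A_-$ with the same domain and the same pseudo-sections are pseudo-equal. Let $\square_*$ be the category with objects $\square^n=\{0,1\}^n$, $n\ge 0$, and all maps of sets, monoidal under $\square^m\otimes\square^n=\square^{m+n}$. The cubical sites below are the wide monoidal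 subcategories of $\square_*$ generated by the two faces $\square^0\to\square^1$, the projection $\square^1\to\square^0$, and the maps indicated by the subscripts: $d$: the diagonals $\square^n\to\square^{2n}$, $x\mapsto(x,x)$; $s$: the symmetry $\square^2\to\square^2$, $(x,y)\mapsto(y,x)$; $c^\wedge$, $c^\vee$: the connection $\wedge$, respectively $\vee$, $\square^2\to\square^1$; $c$: both connections; $r$: the reversal $\square^1\to\square^1$ exchanging $0$ and $1$. **Theorem.** 1. Each of the sites $\square_{d,s}$ and $\square_{d,s,r}$, with the degree function $\deg\square^n=n$, carries the structure of a strongly skeletal generalized Reedy category, which is moreover Eilenberg–Zilber. 2. Each of the sites $\square_{d,c^\wedge,s}$, $\square_{d,c^\vee,s}$, $\square_{d,c,s}$ is not idempotent complete, and is not a generalized Reedy category for any degree function and factorization system. In its idempotent completion (Karoubi envelope), the split epimorphisms are not the left class of any orthogonal factorization system, and the idempotent completion is not an Eilenberg–Zilber category for any degree function and factorization system. 3. The site $\square_{d,c,s,r}$ is not idempotent complete, and is not a generalized Reedy category for any degree function and factorization system. Its idempotent completion is equivalent to the category of finite nonempty sets and all maps, by an equivalence that restricts on $\square_{d,c,s,r}$,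 up to isomorphism, to the functor sending a cube to its underlying set of vertices. With degree the number of elements, the category of finite nonempty sets, and likewise the idempotent completion (with the degree carried over along the equivalence), is a strongly skeletal generalized Reedy category for a suitable factorization system, and this structure is moreover Eilenberg–Zilber. -/

import Mathlib

open CategoryTheory

universe w v u

namespace EZCubes

/-! ### Orthogonal factorization systems and generalized Reedy categories -/

section General

variable {C : Type u} [Category.{v} C]

/-- An orthogonal factorization system `(L, R)`: both classes contain the isomorphisms and are
closed under composition, every morphism is a morphism of `L` followed by a morphism of `R`, and
the morphisms of `L` have the unique left lifting property against the morphisms of `R`. -/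
structure IsOrthogonalFactorizationSystem (L R : MorphismProperty C) : Prop where
  left_of_isIso : ∀ {X Y : C} (f : X ⟶ Y), IsIso f → L f
  right_of_isIso : ∀ {X Y : C} (f : X ⟶ Y), IsIso f → R f
  left_comp : ∀ {X Y Z : C} (f : X ⟶ Y) (g : Y ⟶ Z), L f → L g → L (f ≫ g)
  right_comp : ∀ {X Y Z : C} (f : X ⟶ Y) (g : Y ⟶ Z), R f → R g → R (f ≫ g)
  exists_factorization : ∀ {X Y : C} (f : X ⟶ Y),
    ∃ (Z : C) (l : X ⟶ Z) (r : Z ⟶ Y), L l ∧ R r ∧ l ≫ r = f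
  existsUnique_lift : ∀ {A B X Y : C} (l : A ⟶ B) (r : X ⟶ Y), L l → R r →
    ∀ (a : A ⟶ X) (b : B ⟶ Y), a ≫ r = l ≫ b → ∃! d : B ⟶ X, l ≫ d = a ∧ d ≫ r = b

/-- `(C, deg, L, R)` is a generalized Reedy category, with `L = C₋` and `R = C₊`. -/
structure IsGeneralizedReedy (deg : C → ℕ) (L R : MorphismProperty C) : Prop
    extends IsOrthogonalFactorizationSystem L R where
  essentiallySmall : EssentiallySmall.{v} C
  deg_eq_of_iso : ∀ {X Y : C}, Nonempty (X ≅ Y) → deg X = deg Y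
  left_lowers : ∀ {X Y : C} (f : X ⟶ Y), L f → ¬ IsIso f → deg Y < deg X
  right_raises : ∀ {X Y : C} (f : X ⟶ Y), R f → ¬ IsIso f → deg X < deg Y

/-- `i` is a pseudo-section of `p` if `p ∘ i` is an isomorphism. -/
def IsPseudoSection {a b c : C} (p : a ⟶ b) (i : c ⟶ a) : Prop :=
  IsIso (i ≫ p)

/-- `p : a ⟶ b` and `p' : a ⟶ b'` are pseudo-equal if they differ by an isomorphism `b ≅ b'`. -/
def PseudoEqual {a b b' : C} (p : a ⟶ b) (p' : a ⟶ b') : Prop :=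
  ∃ φ : b ≅ b', p ≫ φ.hom = p'

/-- Strongly skeletal generalized Reedy categories. -/
structure IsStronglySkeletal (deg : C → ℕ) (L R : MorphismProperty C) : Prop
    extends IsGeneralizedReedy deg L R where
  left_isSplitEpi : ∀ {X Y : C} (f : X ⟶ Y), L f → IsSplitEpi f
  pseudoEqual_of_pseudoSections : ∀ {a b b' : C} (p : a ⟶ b) (p' : a ⟶ b'), L p → L p' →
    (∀ (c : C) (i : c ⟶ a), IsPseudoSection p i ↔ IsPseudoSection p' i) → PseudoEqual p p'

/-- A pushout square that is preserved by every functor to every category. Every category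
embeds, up to lifting of universes, in a large one, so it suffices to let `w` vary. -/
def IsAbsolutePushout {a b c p : C} (f : a ⟶ b) (g : a ⟶ c) (inl : b ⟶ p) (inr : c ⟶ p) : Prop :=
  IsPushout f g inl inr ∧
    ∀ (D : Type (w + 1)) [LargeCategory.{w} D] (F : C ⥤ D),
      IsPushout (F.map f) (F.map g) (F.map inl) (F.map inr)

/-- Eilenberg-Zilber categories. -/
structure IsEilenbergZilber (deg : C → ℕ) (L R : MorphismProperty C) : Prop
    extends IsGeneralizedReedy deg L R where
  exists_absolutePushout : ∀ {a b c : C} (f : a ⟶ b) (g : a ⟶ c), L f → L g →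
    ∃ (p : C) (inl : b ⟶ p) (inr : c ⟶ p), IsAbsolutePushout.{w} f g inl inr

/-- The class of split epimorphisms. -/
def splitEpis (C : Type u) [Category.{v} C] : MorphismProperty C :=
  fun _ _ f => IsSplitEpi f

end General

/-! ### Cubical sites -/

/-- The `n`-cube `{0,1}ⁿ`, as an object of the category of cubes and all set maps. -/
structure Cube : Type where
  dim : ℕ

/-- The set `{0,1}ⁿ` of vertices of the `n`-cube. -/
abbrev Cube.Vertex (X : Cube) : Type := Fin X.dim → Bool

/-- All set maps between the sets `{0,1}ⁿ`. -/
instance : Category.{0} Cube where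
  Hom X Y := X.Vertex → Y.Vertex
  id _ := fun x => x
  comp f g := fun x => g (f x)

/-- The tensor product of maps of cubes, i.e. the cartesian product of maps under the
identification `{0,1}ᵐ⁺ⁿ = {0,1}ᵐ × {0,1}ⁿ`. -/
def Cube.tensor {m m' n n' : ℕ} (f : Cube.mk m ⟶ Cube.mk m') (g : Cube.mk n ⟶ Cube.mk n') :
    Cube.mk (m + n) ⟶ Cube.mk (m' + n') :=
  fun x : Fin (m + n) → Bool =>
    (Fin.append (f fun i => x (Fin.castAdd n i)) (g fun j => x (Fin.natAdd m j)) :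
      Fin (m' + n') → Bool)

/-- The structure maps that a cubical site may have besides faces and projections. -/
inductive Feature : Type where
  | diagonal
  | meetConnection
  | joinConnection
  | symmetry
  | reversal

/-- The maps of the wide monoidal subcategory of `Cube` generated by the faces, the projection
and the structure maps listed in `S`. -/
inductive SiteMap (S : Set Feature) : MorphismProperty Cube
  | face (ε : Bool) :
      SiteMap S (X := Cube.mk 0) (Y := Cube.mk 1) (fun _ _ => ε)
  | proj :
      SiteMap S (X := Cube.mk 1) (Y := Cube.mk 0) (fun _ => Fin.elim0)
  | diagonal (h : Feature.diagonal ∈ S) (n : ℕ) :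
      SiteMap S (X := Cube.mk n) (Y := Cube.mk (n + n)) (fun x => Fin.append x x)
  | meetConnection (h : Feature.meetConnection ∈ S) :
      SiteMap S (X := Cube.mk 2) (Y := Cube.mk 1)
        (fun (x : Fin 2 → Bool) (_ : Fin 1) => x 0 && x 1)
  | joinConnection (h : Feature.joinConnection ∈ S) :
      SiteMap S (X := Cube.mk 2) (Y := Cube.mk 1)
        (fun (x : Fin 2 → Bool) (_ : Fin 1) => x 0 || x 1)
  | symmetry (h : Feature.symmetry ∈ S) :
      SiteMap S (X := Cube.mk 2) (Y := Cube.mk 2)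
        (fun x : Fin 2 → Bool => (![x 1, x 0] : Fin 2 → Bool))
  | reversal (h : Feature.reversal ∈ S) :
      SiteMap S (X := Cube.mk 1) (Y := Cube.mk 1)
        (fun (x : Fin 1 → Bool) (i : Fin 1) => !(x i))
  | id (X : Cube) : SiteMap S (𝟙 X)
  | comp {X Y Z : Cube} (f : X ⟶ Y) (g : Y ⟶ Z) :
      SiteMap S f → SiteMap S g → SiteMap S (f ≫ g)
  | tensor {m m' n n' : ℕ} (f : Cube.mk m ⟶ Cube.mk m') (g : Cube.mk n ⟶ Cube.mk n') :
      SiteMap S f → SiteMap S g → SiteMap S (Cube.tensor f g)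

instance (S : Set Feature) : (SiteMap S).IsMultiplicative where
  id_mem X := SiteMap.id X
  comp_mem f g hf hg := SiteMap.comp f g hf hg

/-- The cubical site with the structure maps listed in `S`. -/
abbrev Site (S : Set Feature) : Type := WideSubcategory (SiteMap S)

/-- The obvious degree function `{0,1}ⁿ ↦ n`. -/
def Site.deg {S : Set Feature} (X : Site S) : ℕ := X.obj.dim

/-! ### Finite nonempty sets -/

/-- The category of finite nonempty sets and all maps between them. -/
abbrev FinNonempty : Type 1 :=
  ObjectProperty.FullSubcategory (C := Type) (fun X => Finite X ∧ Nonempty X)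

/-- The obvious degree function on finite nonempty sets: the number of elements. -/
noncomputable def FinNonempty.deg (X : FinNonempty) : ℕ := Nat.card X.obj

/-- The functor that regards the set of vertices of a cube as a finite nonempty set. -/
def vertexFunctor (S : Set Feature) : Site S ⥤ FinNonempty where
  obj X := ⟨X.obj.Vertex, inferInstance, inferInstance⟩
  map f := ObjectProperty.homMk (TypeCat.ofHom f.hom)

end EZCubes

/-! Positive cases. Take split epimorphisms as the left class and split monomorphisms as the right
class: unique lifting is then automatic, and raising follows from lowering applied to a retraction.
A square witnessed by sections (`isPushout_of_splitting`) is an absolute pushout, because the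
witnessing equations survive any functor. Without connections, each coordinate of a map is a
constant or a possibly negated variable, so split epimorphisms forget coordinates, and their
zero-filling sections give commuting idempotents. For finite sets, a surjection is a succession of
mergers of two points, and pushouts along one merger split. With all generators every Boolean map is
present, so the Karoubi envelope consists of all retracts of cubes, i.e. all finite nonempty sets.

Negative cases. A generalized Reedy category is idempotent complete, whereas a connection yields an
idempotent of the square with three fixed points, and the fixed points of a split idempotent form a
cube. The left class of an Eilenberg-Zilber category must be the split epimorphisms
(`IsEilenbergZilber.left_eq_splitEpis`), so it suffices to exclude a factorization system with that
left class. Such a system would attach to each map `f` an endomorphism `e` over `f` that respects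
the identifications along idempotents made by `f`. With one connection this fails for a map whose
image is a pentagon, since `e` preserves the semilattice operation; with both, for a map whose image
is a five-element chain, since `e` is monotone. -/

namespace EZCubes

/-! ### Criteria and obstructions in an arbitrary category. -/

section Criteria

open Limits

universe v' u'

variable {C : Type u} [Category.{v} C] {D : Type u'} [Category.{v'} D]

/-- The class of split monomorphisms. -/
def splitMonos (C : Type u) [Category.{v} C] : MorphismProperty C :=
  fun _ _ f => IsSplitMono f

/-! ### Absolute pushouts -/

/-- Since `k` is a section of `s`, the descent of a cocone `t` can only be `k ≫ t.inr`; the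
remaining equations show that it works. No universal property is assumed, hence absoluteness. -/
lemma isPushout_of_splitting {a b c d : C} {p : a ⟶ b} {q : a ⟶ c} {r : b ⟶ d} {s : c ⟶ d}
    {i : b ⟶ a} {j : c ⟶ a} {k : d ⟶ c} (w : p ≫ r = q ≫ s) (hi : i ≫ p = 𝟙 b)
    (hj : j ≫ q = 𝟙 c) (hk : k ≫ s = 𝟙 d) (h : r ≫ k = i ≫ q) : IsPushout p q r s := by
  refine ⟨⟨w⟩, ⟨PushoutCocone.IsColimit.mk w (fun t => k ≫ t.inr) ?_ ?_ ?_⟩⟩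
  · intro t
    rw [← Category.assoc, h, Category.assoc, ← t.condition, reassoc_of% hi]
  · intro t
    have key : q ≫ s ≫ k ≫ t.inr = q ≫ t.inr := by
      rw [← reassoc_of% w, reassoc_of% h, ← t.condition, reassoc_of% hi]
    have := j ≫= key
    rwa [reassoc_of% hj, reassoc_of% hj] at this
  · intro t m _ hm
    rw [← hm, reassoc_of% hk]

lemma IsAbsolutePushout.of_splitting {a b c d : C} {p : a ⟶ b} {q : a ⟶ c} {r : b ⟶ d}
    {s : c ⟶ d} {i : b ⟶ a} {j : c ⟶ a} {k : d ⟶ c} (w : p ≫ r = q ≫ s) (hi : i ≫ p = 𝟙 b)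
    (hj : j ≫ q = 𝟙 c) (hk : k ≫ s = 𝟙 d) (h : r ≫ k = i ≫ q) :
    IsAbsolutePushout.{w} p q r s :=
  ⟨isPushout_of_splitting w hi hj hk h, fun E _ F =>
    isPushout_of_splitting (i := F.map i) (j := F.map j) (k := F.map k)
      (by simp only [← F.map_comp, w]) (by rw [← F.map_comp, hi, F.map_id])
      (by rw [← F.map_comp, hj, F.map_id]) (by rw [← F.map_comp, hk, F.map_id])
      (by simp only [← F.map_comp, h])⟩

lemma IsAbsolutePushout.paste {a b c c' d d' : C} {p : a ⟶ b} {q : a ⟶ c} {r : b ⟶ d}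
    {s : c ⟶ d} {q' : c ⟶ c'} {r' : d ⟶ d'} {s' : c' ⟶ d'} (h : IsAbsolutePushout.{w} p q r s)
    (h' : IsAbsolutePushout.{w} s q' r' s') :
    IsAbsolutePushout.{w} p (q ≫ q') (r ≫ r') s' :=
  ⟨h.1.paste_vert h'.1, fun E _ F => by
    simpa only [F.map_comp] using (h.2 E F).paste_vert (h'.2 E F)⟩

lemma IsAbsolutePushout.of_iso {a b c d a' b' c' d' : C} {p : a ⟶ b} {q : a ⟶ c} {r : b ⟶ d}
    {s : c ⟶ d} {p' : a' ⟶ b'} {q' : a' ⟶ c'} {r' : b' ⟶ d'} {s' : c' ⟶ d'}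
    (h : IsAbsolutePushout.{w} p q r s) (ea : a ≅ a') (eb : b ≅ b') (ec : c ≅ c') (ed : d ≅ d')
    (hp : p ≫ eb.hom = ea.hom ≫ p') (hq : q ≫ ec.hom = ea.hom ≫ q')
    (hr : r ≫ ed.hom = eb.hom ≫ r') (hs : s ≫ ed.hom = ec.hom ≫ s') :
    IsAbsolutePushout.{w} p' q' r' s' :=
  ⟨h.1.of_iso ea eb ec ed hp hq hr hs, fun E _ F =>
    (h.2 E F).of_iso (F.mapIso ea) (F.mapIso eb) (F.mapIso ec) (F.mapIso ed)
      (by simp only [Functor.mapIso_hom, ← F.map_comp, hp])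
      (by simp only [Functor.mapIso_hom, ← F.map_comp, hq])
      (by simp only [Functor.mapIso_hom, ← F.map_comp, hr])
      (by simp only [Functor.mapIso_hom, ← F.map_comp, hs])⟩

lemma IsAbsolutePushout.map {a b c d : C} {p : a ⟶ b} {q : a ⟶ c} {r : b ⟶ d} {s : c ⟶ d}
    (h : IsAbsolutePushout.{w} p q r s) (G : C ⥤ D) [G.IsEquivalence] :
    IsAbsolutePushout.{w} (G.map p) (G.map q) (G.map r) (G.map s) :=
  ⟨h.1.map G, fun E _ F => h.2 E (G ⋙ F)⟩

/-! ### Categories in which every morphism is a split epimorphism followed by a split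
monomorphism -/

/-- An Eilenberg-Zilber category, strongly skeletal, for the classes of split epimorphisms and
split monomorphisms. -/
structure IsSplitEilenbergZilber (deg : C → ℕ) : Prop where
  essentiallySmall : EssentiallySmall.{v} C
  exists_factorization : ∀ {X Y : C} (f : X ⟶ Y),
    ∃ (Z : C) (l : X ⟶ Z) (r : Z ⟶ Y), IsSplitEpi l ∧ IsSplitMono r ∧ l ≫ r = f
  deg_eq_of_iso : ∀ {X Y : C}, Nonempty (X ≅ Y) → deg X = deg Y
  isSplitEpi_lowers : ∀ {X Y : C} (f : X ⟶ Y), IsSplitEpi f → ¬ IsIso f → deg Y < deg X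
  pseudoEqual_of_pseudoSections : ∀ {a b b' : C} (p : a ⟶ b) (p' : a ⟶ b'),
    IsSplitEpi p → IsSplitEpi p' →
    (∀ (c : C) (i : c ⟶ a), IsPseudoSection p i ↔ IsPseudoSection p' i) → PseudoEqual p p'
  exists_absolutePushout : ∀ {a b c : C} (f : a ⟶ b) (g : a ⟶ c),
    IsSplitEpi f → IsSplitEpi g →
    ∃ (p : C) (inl : b ⟶ p) (inr : c ⟶ p), IsAbsolutePushout.{w} f g inl inr

lemma IsSplitEilenbergZilber.isGeneralizedReedy {deg : C → ℕ}
    (h : IsSplitEilenbergZilber.{w} deg) :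
    IsGeneralizedReedy deg (splitEpis C) (splitMonos C) where
  left_of_isIso f _ := (inferInstance : IsSplitEpi f)
  right_of_isIso f _ := (inferInstance : IsSplitMono f)
  left_comp f g hf hg := by
    have : IsSplitEpi f := hf
    have : IsSplitEpi g := hg
    exact (inferInstance : IsSplitEpi (f ≫ g))
  right_comp f g hf hg := by
    have : IsSplitMono f := hf
    have : IsSplitMono g := hg
    exact (inferInstance : IsSplitMono (f ≫ g))
  exists_factorization f := h.exists_factorization f
  existsUnique_lift l r hl hr a b w := by
    have : IsSplitEpi l := hl
    have : IsSplitMono r := hr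
    have hd : (section_ l ≫ a) ≫ r = b := by rw [Category.assoc, w, IsSplitEpi.id_assoc]
    refine ⟨section_ l ≫ a, ⟨?_, hd⟩, ?_⟩
    · rw [← cancel_mono r, Category.assoc, hd, w]
    · rintro d ⟨-, h2⟩
      rw [← cancel_mono r, h2, hd]
  essentiallySmall := h.essentiallySmall
  deg_eq_of_iso := h.deg_eq_of_iso
  left_lowers f hf hi := h.isSplitEpi_lowers f hf hi
  right_raises f hf hi := by
    have : IsSplitMono f := hf
    refine h.isSplitEpi_lowers (retraction f) inferInstance fun hr => hi ?_
    have : f = inv (retraction f) := by rw [← cancel_mono (retraction f)]; simp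
    rw [this]
    infer_instance

lemma IsSplitEilenbergZilber.isStronglySkeletal {deg : C → ℕ}
    (h : IsSplitEilenbergZilber.{w} deg) :
    IsStronglySkeletal deg (splitEpis C) (splitMonos C) where
  toIsGeneralizedReedy := h.isGeneralizedReedy
  left_isSplitEpi _ hf := hf
  pseudoEqual_of_pseudoSections p p' hp hp' hi := h.pseudoEqual_of_pseudoSections p p' hp hp' hi

lemma IsSplitEilenbergZilber.isEilenbergZilber {deg : C → ℕ}
    (h : IsSplitEilenbergZilber.{w} deg) :
    IsEilenbergZilber.{w} deg (splitEpis C) (splitMonos C) where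
  toIsGeneralizedReedy := h.isGeneralizedReedy
  exists_absolutePushout f g hf hg := h.exists_absolutePushout f g hf hg

lemma IsSplitEilenbergZilber.of_equivalence {deg : C → ℕ} (h : IsSplitEilenbergZilber.{w} deg)
    (e : D ≌ C) (hD : EssentiallySmall.{v'} D) :
    IsSplitEilenbergZilber.{w} (fun X : D => deg (e.functor.obj X)) where
  essentiallySmall := hD
  exists_factorization {X Y} f := by
    obtain ⟨Z, l, r, hl, hr, w⟩ := h.exists_factorization (e.functor.map f)
    refine ⟨e.inverse.obj Z, e.unit.app X ≫ e.inverse.map l, e.inverse.map r ≫ e.unitInv.app Y,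
      inferInstance, inferInstance, ?_⟩
    rw [Category.assoc, ← Functor.map_comp_assoc, w]
    simp
  deg_eq_of_iso := fun ⟨i⟩ => h.deg_eq_of_iso ⟨e.functor.mapIso i⟩
  isSplitEpi_lowers f hf hi :=
    h.isSplitEpi_lowers (e.functor.map f) inferInstance fun _ =>
      hi (isIso_of_reflects_iso f e.functor)
  pseudoEqual_of_pseudoSections {a b b'} p p' hp hp' hi := by
    -- Being a pseudo-section is invariant under isomorphisms of the source, so it can be tested on
    -- morphisms coming from `D`.
    have key : ∀ (c : C) (i : c ⟶ e.functor.obj a), ∃ (c' : D) (i' : c' ⟶ a)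
        (φ : e.functor.obj c' ≅ c), e.functor.map i' = φ.hom ≫ i := fun c i =>
      ⟨e.inverse.obj c, e.functor.preimage (e.counit.app c ≫ i), e.counitIso.app c, by simp⟩
    obtain ⟨φ, hφ⟩ := h.pseudoEqual_of_pseudoSections (e.functor.map p) (e.functor.map p')
      inferInstance inferInstance fun c i => by
        obtain ⟨c', i', φ, hφ⟩ := key c i
        have aux : ∀ {b : D} (p : a ⟶ b),
            IsPseudoSection (e.functor.map p) i ↔ IsPseudoSection p i' := fun p => by
          unfold IsPseudoSection
          rw [← isIso_iff_of_reflects_iso (i' ≫ p) e.functor, Functor.map_comp, hφ,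
            Category.assoc, isIso_comp_left_iff φ.hom]
        rw [aux, aux, hi]
    exact ⟨e.functor.preimageIso φ, e.functor.map_injective (by simpa using hφ)⟩
  exists_absolutePushout {a b c} f g hf hg := by
    obtain ⟨d, r, s, H⟩ := h.exists_absolutePushout (e.functor.map f) (e.functor.map g)
      inferInstance inferInstance
    refine ⟨e.inverse.obj d, e.unit.app b ≫ e.inverse.map r, e.unit.app c ≫ e.inverse.map s,
      (H.map e.inverse).of_iso (e.unitIso.app a).symm (e.unitIso.app b).symm
        (e.unitIso.app c).symm (Iso.refl _) ?_ ?_ ?_ ?_⟩ <;> simp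

/-- Split epimorphisms whose associated idempotents commute have an absolute pushout. -/
lemma exists_absolutePushout_of_commute
    (hC : ∀ {X Y : C} (f : X ⟶ Y), ∃ (Z : C) (l : X ⟶ Z) (r : Z ⟶ Y),
      IsSplitEpi l ∧ IsSplitMono r ∧ l ≫ r = f)
    {a b c : C} {p : a ⟶ b} {q : a ⟶ c} {i : b ⟶ a} {j : c ⟶ a}
    (hi : i ≫ p = 𝟙 b) (hj : j ≫ q = 𝟙 c) (h : (p ≫ i) ≫ (q ≫ j) = (q ≫ j) ≫ (p ≫ i)) :
    ∃ (d : C) (r : b ⟶ d) (s : c ⟶ d), IsAbsolutePushout.{w} p q r s := by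
  -- The pushout object is the image of `i ≫ q`, which represents the common image of the two
  -- commuting idempotents.
  obtain ⟨d, r, k, hr, hk, hrk⟩ := hC (i ≫ q)
  simp only [Category.assoc] at h
  refine ⟨d, r, j ≫ p ≫ r, .of_splitting (i := i) (j := j) (k := k) ?_ hi hj ?_ hrk⟩
  · rw [← cancel_mono k]
    simp only [Category.assoc, hrk]
    have := h =≫ q
    simp only [Category.assoc, hj, Category.comp_id] at this
    exact this
  · rw [← cancel_epi r, ← cancel_mono k]
    simp only [Category.assoc, hrk, Category.comp_id]
    rw [reassoc_of% hrk]
    have := i ≫= h =≫ q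
    simp only [Category.assoc, hj, Category.comp_id, reassoc_of% hi] at this
    exact this.symm

/-! ### Obstructions -/

lemma IsOrthogonalFactorizationSystem.factorization_unique {L R : MorphismProperty C}
    (h : IsOrthogonalFactorizationSystem L R) {X Z Z' Y : C} {l : X ⟶ Z} {r : Z ⟶ Y}
    {l' : X ⟶ Z'} {r' : Z' ⟶ Y} (hl : L l) (hr : R r) (hl' : L l') (hr' : R r')
    (w : l ≫ r = l' ≫ r') : ∃ φ : Z ≅ Z', l ≫ φ.hom = l' ∧ φ.hom ≫ r' = r := by
  obtain ⟨d, ⟨hd1, hd2⟩, -⟩ := h.existsUnique_lift l r' hl hr' l' r w.symm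
  obtain ⟨d', ⟨hd1', hd2'⟩, -⟩ := h.existsUnique_lift l' r hl' hr l r' w
  refine ⟨⟨d, d', ?_, ?_⟩, hd1, hd2⟩
  · exact (h.existsUnique_lift l r hl hr l r rfl).unique
      ⟨by rw [reassoc_of% hd1, hd1'], by rw [Category.assoc, hd2', hd2]⟩ ⟨by simp, by simp⟩
  · exact (h.existsUnique_lift l' r' hl' hr' l' r' rfl).unique
      ⟨by rw [reassoc_of% hd1', hd1], by rw [Category.assoc, hd2, hd2']⟩ ⟨by simp, by simp⟩

lemma IsGeneralizedReedy.isIso_left {deg : C → ℕ} {L R : MorphismProperty C}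
    (h : IsGeneralizedReedy deg L R) {X Y : C} {f : X ⟶ Y} (hf : L f) (hd : deg X ≤ deg Y) :
    IsIso f := by
  by_contra hi
  exact absurd (h.left_lowers f hf hi) (by omega)

lemma IsGeneralizedReedy.isIso_right {deg : C → ℕ} {L R : MorphismProperty C}
    (h : IsGeneralizedReedy deg L R) {X Y : C} {f : X ⟶ Y} (hf : R f) (hd : deg Y ≤ deg X) :
    IsIso f := by
  by_contra hi
  exact absurd (h.right_raises f hf hi) (by omega)

lemma IsGeneralizedReedy.deg_le_right {deg : C → ℕ} {L R : MorphismProperty C}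
    (h : IsGeneralizedReedy deg L R) {X Y : C} {f : X ⟶ Y} (hf : R f) : deg X ≤ deg Y := by
  by_cases hi : IsIso f
  · exact (h.deg_eq_of_iso ⟨asIso f⟩).le
  · exact (h.right_raises f hf hi).le

/-- Factor `e = l ≫ r` and then `r ≫ l = l' ≫ r'`. As `e` is idempotent, `(l ≫ l') ≫ (r' ≫ r)` is a
second factorization of `e`; uniqueness equates degrees, so `l'` and `r'` are isomorphisms. -/
lemma IsGeneralizedReedy.isIdempotentComplete {deg : C → ℕ} {L R : MorphismProperty C}
    (h : IsGeneralizedReedy deg L R) : IsIdempotentComplete C where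
  idempotents_split X e he := by
    obtain ⟨Z, l, r, hl, hr, hlr⟩ := h.exists_factorization e
    obtain ⟨Z', l', r', hl', hr', hlr'⟩ := h.exists_factorization (r ≫ l)
    have w : (l ≫ l') ≫ (r' ≫ r) = l ≫ r := by
      rw [hlr, ← he, ← hlr]
      simp only [Category.assoc]
      rw [reassoc_of% hlr']
    obtain ⟨φ, -, -⟩ := h.factorization_unique (h.left_comp _ _ hl hl')
      (h.right_comp _ _ hr' hr) hl hr w
    have hd := h.deg_eq_of_iso ⟨φ⟩
    have : IsIso l' := h.isIso_left hl' hd.ge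
    have : IsIso r' := h.isIso_right hr' hd.ge
    have hu : IsIso (r ≫ l) := by rw [← hlr']; infer_instance
    -- With `u = r ≫ l` invertible, comparing the factorizations `l ≫ r` and `(l ≫ u) ≫ r` forces `θ
    -- = u`, hence `u ≫ r = r` and finally `u = 𝟙`.
    obtain ⟨θ, hθ1, hθ2⟩ := h.factorization_unique hl hr
      (h.left_comp _ _ hl (h.left_of_isIso _ hu)) hr
      (show l ≫ r = (l ≫ r ≫ l) ≫ r by
        simp only [Category.assoc]; rw [reassoc_of% hlr, hlr, he])
    have h1 : (r ≫ l) ≫ θ.hom = (r ≫ l) ≫ (r ≫ l) := by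
      rw [Category.assoc, hθ1, Category.assoc]
    rw [cancel_epi] at h1
    rw [h1] at hθ2
    refine ⟨Z, r, l, ?_, hlr⟩
    rw [← cancel_epi (r ≫ l)]
    simpa using hθ2 =≫ l

lemma _root_.CategoryTheory.IsPushout.epi_of_inl_eq_inr {X Y P : C} {f : X ⟶ Y} {i : Y ⟶ P}
    (h : IsPushout f f i i) : Epi f where
  left_cancellation g g' w := by rw [← h.inl_desc g g' w, h.inr_desc]

/-- The left class of an Eilenberg-Zilber category consists of the split epimorphisms. -/
lemma IsEilenbergZilber.left_eq_splitEpis {C : Type u} [Category.{0} C] {deg : C → ℕ}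
    {L R : MorphismProperty C} (h : IsEilenbergZilber.{w} deg L R) : L = splitEpis C := by
  ext X Y f
  refine ⟨fun hf => ?_, fun hf => ?_⟩
  · obtain ⟨P, inl, inr, hP, hA⟩ := h.exists_absolutePushout f f hf hf
    let H (Z : C) : C ⥤ Type w := uliftCoyoneda.{w}.obj (Opposite.op Z)
    -- Representable functors preserve the pushout, and each element of a pushout of sets comes from
    -- one of the two legs.
    have hsurj : ∀ (Z : C) (z : Z ⟶ P), (∃ y, y ≫ inl = z) ∨ ∃ y, y ≫ inr = z := by
      intro Z z
      rcases Types.eq_or_eq_of_isPushout (hA _ (H Z)) ⟨z⟩ with ⟨y, hy⟩ | ⟨y, hy⟩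
      · exact .inl ⟨y.down, congrArg ULift.down hy⟩
      · exact .inr ⟨y.down, congrArg ULift.down hy⟩
    have hc : inl ≫ hP.desc (𝟙 Y) (𝟙 Y) rfl = 𝟙 Y := hP.inl_desc _ _ _
    have hc' : inr ≫ hP.desc (𝟙 Y) (𝟙 Y) rfl = 𝟙 Y := hP.inr_desc _ _ _
    -- Apply this to the identity of `P`: one leg has a left inverse `y` for composition, which must
    -- be the codiagonal; the codiagonal is thus an isomorphism inverse to both legs.
    have hlr : inl = inr := by
      rcases hsurj P (𝟙 P) with ⟨y, hy⟩ | ⟨y, hy⟩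
      · have h1 : y = hP.desc (𝟙 Y) (𝟙 Y) rfl := by
          simpa [hc] using hy =≫ hP.desc (𝟙 Y) (𝟙 Y) rfl
        rw [← h1] at hc'
        simpa [hy] using (hc' =≫ inl).symm
      · have h1 : y = hP.desc (𝟙 Y) (𝟙 Y) rfl := by
          simpa [hc'] using hy =≫ hP.desc (𝟙 Y) (𝟙 Y) rfl
        rw [← h1] at hc
        simpa [hy] using hc =≫ inr
    subst hlr
    -- With equal legs the pushout says that `f` induces a surjection on maps out of `Y`; a preimage
    -- of the identity is a section.
    have hepi : Epi ((H Y).map f) := (hA _ (H Y)).epi_of_inl_eq_inr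
    rw [epi_iff_surjective] at hepi
    obtain ⟨⟨y⟩, hy⟩ := hepi ⟨𝟙 Y⟩
    exact IsSplitEpi.mk' ⟨y, congrArg ULift.down hy⟩
  · have : IsSplitEpi f := hf
    obtain ⟨Z, l, r, hl, hr, hlr⟩ := h.exists_factorization f
    -- This factors the identity of `Y` through `Z'`, so `deg Y = deg Z' ≤ deg Z`, and `r : Z ⟶ Y`
    -- cannot raise the degree.
    obtain ⟨Z', l', r', hl', hr', hlr'⟩ := h.exists_factorization (section_ f ≫ l)
    have w : l' ≫ r' ≫ r = 𝟙 Y ≫ 𝟙 Y := by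
      rw [reassoc_of% hlr', hlr]; simp
    obtain ⟨φ, -, -⟩ := h.factorization_unique hl' (h.right_comp _ _ hr' hr)
      (h.left_of_isIso (𝟙 Y) inferInstance) (h.right_of_isIso (𝟙 Y) inferInstance) w
    have hd := h.deg_eq_of_iso ⟨φ⟩
    have hr'' := h.deg_le_right hr'
    have : IsIso r := h.isIso_right hr (by omega)
    rw [← hlr]
    exact h.left_comp _ _ hl (h.left_of_isIso _ this)

lemma not_exists_isEilenbergZilber {C : Type u} [Category.{0} C]
    (h : ¬ ∃ R : MorphismProperty C, IsOrthogonalFactorizationSystem (splitEpis C) R) :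
    ¬ ∃ (deg : C → ℕ) (L R : MorphismProperty C), IsEilenbergZilber.{w} deg L R := by
  rintro ⟨deg, L, R, H⟩
  obtain rfl := H.left_eq_splitEpis
  exact h ⟨R, H.toIsOrthogonalFactorizationSystem⟩

lemma not_exists_isGeneralizedReedy (h : ¬ IsIdempotentComplete C) :
    ¬ ∃ (deg : C → ℕ) (L R : MorphismProperty C), IsGeneralizedReedy deg L R := by
  rintro ⟨deg, L, R, H⟩
  exact h H.isIdempotentComplete

/-- If the split epimorphisms of the Karoubi envelope are the left class of an orthogonal
factorization system, then every `f : X ⟶ Y` is invariant under an endomorphism `e` of `X` that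
respects all identifications along idempotents made by `f`. -/
lemma IsOrthogonalFactorizationSystem.exists_endomorphism
    {R : MorphismProperty (Idempotents.Karoubi C)}
    (h : IsOrthogonalFactorizationSystem (splitEpis (Idempotents.Karoubi C)) R)
    {X Y : C} (f : X ⟶ Y) :
    ∃ e : X ⟶ X, e ≫ f = f ∧ ∀ (A : C) (a : A ⟶ X) (ε : A ⟶ A), ε ≫ ε = ε →
      ε ≫ a ≫ f = a ≫ f → ε ≫ a ≫ e = a ≫ e := by
  obtain ⟨Z, l, r, hl, hr, hlr⟩ := h.exists_factorization ((Idempotents.toKaroubi C).map f)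
  have : IsSplitEpi l := hl
  let F := Idempotents.toKaroubi C
  refine ⟨(l ≫ section_ l).f, ?_, ?_⟩
  · have : (l ≫ section_ l) ≫ F.map f = F.map f := by
      rw [← hlr, Category.assoc, IsSplitEpi.id_assoc]
    exact congrArg Idempotents.Karoubi.Hom.f this
  · intro A a ε hε hf
    obtain ⟨B, σ, τ, h1, h2⟩ := (inferInstance : IsIdempotentComplete
      (Idempotents.Karoubi C)).idempotents_split _ (F.map ε) (by rw [← F.map_comp, hε])
    have hτ : splitEpis _ τ := IsSplitEpi.mk' ⟨σ, h1⟩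
    -- `f` after `a` factors through the splitting `τ` of `ε`; lifting `τ` against `r` makes `a ≫ l`
    -- factor through `τ` too.
    obtain ⟨d, ⟨hd, -⟩, -⟩ := h.existsUnique_lift τ r hτ hr (F.map a ≫ l)
      (σ ≫ F.map a ≫ F.map f) (by
        rw [reassoc_of% h2, Category.assoc, hlr]
        simp only [F, ← Functor.map_comp, hf])
    have key : F.map ε ≫ F.map a ≫ l = F.map a ≫ l := by
      rw [← hd, ← h2, Category.assoc, reassoc_of% h1]
    have := congrArg Idempotents.Karoubi.Hom.f (key =≫ section_ l)
    simpa [F] using this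

end Criteria


/-! ### Cubical sites through the Boolean functions they contain. -/

section Sites

variable {S : Set Feature}

/-! ### Maps in cubical sites -/

/-- The map `{0,1}ᵐ → {0,1}ⁿ` belongs to the cubical site with structure maps `S`. -/
def IsSiteMap (S : Set Feature) {m n : ℕ} (f : (Fin m → Bool) → Fin n → Bool) : Prop :=
  SiteMap S (X := Cube.mk m) (Y := Cube.mk n) f

/-- The Boolean function `{0,1}ᵐ → {0,1}` belongs to the cubical site with structure maps `S`. -/
def IsSiteFun (S : Set Feature) {m : ℕ} (g : (Fin m → Bool) → Bool) : Prop :=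
  IsSiteMap S (fun x (_ : Fin 1) => g x)

/-- The morphism of a cubical site given by a map of vertices. -/
def siteHom {X Y : Site S} (f : X.obj.Vertex → Y.obj.Vertex) (hf : IsSiteMap S f) : X ⟶ Y :=
  ⟨f, hf⟩

lemma isSiteMap_hom {X Y : Site S} (f : X ⟶ Y) : IsSiteMap S f.hom := f.property

lemma comp_hom_apply {X Y Z : Site S} (f : X ⟶ Y) (g : Y ⟶ Z) (x : X.obj.Vertex) :
    (f ≫ g).hom x = g.hom (f.hom x) := rfl

lemma id_hom_apply (X : Site S) (x : X.obj.Vertex) : (𝟙 X : X ⟶ X).hom x = x := rfl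

lemma site_hom_ext {X Y : Site S} {f g : X ⟶ Y} (h : ∀ x, f.hom x = g.hom x) : f = g :=
  WideSubcategory.hom_ext _ (funext h)

lemma IsSiteMap.comp {m n k : ℕ} {f : (Fin m → Bool) → Fin n → Bool}
    {g : (Fin n → Bool) → Fin k → Bool} (hg : IsSiteMap S g) (hf : IsSiteMap S f) :
    IsSiteMap S (fun x => g (f x)) :=
  SiteMap.comp (X := Cube.mk m) (Y := Cube.mk n) (Z := Cube.mk k) f g hf hg

lemma isSiteMap_id (m : ℕ) : IsSiteMap S (fun x : Fin m → Bool => x) := SiteMap.id (Cube.mk m)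

lemma IsSiteMap.tensor {m m' n n' : ℕ} {f : (Fin m → Bool) → Fin m' → Bool}
    {g : (Fin n → Bool) → Fin n' → Bool} (hf : IsSiteMap S f) (hg : IsSiteMap S g) :
    IsSiteMap S (fun x : Fin (m + n) → Bool =>
      (Fin.append (f fun i => x (Fin.castAdd n i)) (g fun j => x (Fin.natAdd m j)) :
        Fin (m' + n') → Bool)) :=
  SiteMap.tensor (m := m) (m' := m') (n := n) (n' := n') f g hf hg

lemma isSiteMap_zero {m : ℕ} (f : (Fin m → Bool) → Fin 0 → Bool) : IsSiteMap S f := by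
  induction m with
  | zero =>
    rw [show f = fun x => x from funext fun _ => Subsingleton.elim _ _]
    exact isSiteMap_id 0
  | succ m ih =>
    have h := (ih fun _ => Fin.elim0).tensor (SiteMap.proj (S := S))
    rwa [show f = _ from funext fun _ => Subsingleton.elim _ _]

lemma isSiteFun_apply {m : ℕ} (i : Fin m) : IsSiteFun S (fun x => x i) := by
  induction m with
  | zero => exact i.elim0
  | succ m ih =>
    induction i using Fin.lastCases with
    | last =>
      have h := (isSiteMap_zero (S := S) fun (_ : Fin m → Bool) => Fin.elim0).tensor
        (isSiteMap_id 1)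
      unfold IsSiteFun
      convert h using 1
      funext x j
      rw [Subsingleton.elim j (Fin.natAdd 0 (0 : Fin 1) : Fin (0 + 1))]
      exact (Fin.append_right (fun i : Fin 0 => i.elim0)
        (fun j : Fin 1 => x (Fin.natAdd m j)) 0).symm
    | cast i =>
      have h := IsSiteMap.tensor (ih i) (SiteMap.proj (S := S))
      unfold IsSiteFun
      convert h using 1
      funext x j
      rw [Subsingleton.elim j (Fin.castAdd 0 (0 : Fin 1) : Fin (1 + 0))]
      exact (Fin.append_left (fun _ : Fin 1 => x i.castSucc)
        (fun i : Fin 0 => (i.elim0 : Bool)) 0).symm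

lemma IsSiteFun.comp {m n : ℕ} {g : (Fin n → Bool) → Bool} {f : (Fin m → Bool) → Fin n → Bool}
    (hg : IsSiteFun S g) (hf : IsSiteMap S f) : IsSiteFun S (fun x => g (f x)) :=
  IsSiteMap.comp hg hf

lemma isSiteFun_const {m : ℕ} (b : Bool) : IsSiteFun S (fun _ : Fin m → Bool => b) :=
  IsSiteMap.comp (SiteMap.face (S := S) b) (isSiteMap_zero fun _ => Fin.elim0)

lemma IsSiteMap.append (hd : Feature.diagonal ∈ S) {m n k : ℕ}
    {f : (Fin m → Bool) → Fin n → Bool} {g : (Fin m → Bool) → Fin k → Bool}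
    (hf : IsSiteMap S f) (hg : IsSiteMap S g) :
    IsSiteMap S (fun x => Fin.append (f x) (g x)) := by
  have h := (hf.tensor hg).comp (SiteMap.diagonal hd m)
  simpa only [Fin.append_left, Fin.append_right] using h

/-- Diagonals allow tupling, so membership in the site reduces to single Boolean functions. -/
lemma isSiteMap_of_coordinates (hd : Feature.diagonal ∈ S) {m n : ℕ}
    {f : (Fin m → Bool) → Fin n → Bool} (hf : ∀ j, IsSiteFun S (fun x => f x j)) :
    IsSiteMap S f := by
  induction n with
  | zero => exact isSiteMap_zero f
  | succ n ih =>
    have h := (ih fun j => hf j.castSucc).append hd (hf (Fin.last n))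
    convert h using 1
    funext x j
    induction j using Fin.lastCases with
    | last => exact (Fin.append_right (fun j => f x j.castSucc)
        (fun _ : Fin 1 => f x (Fin.last n)) 0).symm
    | cast j => exact (Fin.append_left (fun j => f x j.castSucc)
        (fun _ : Fin 1 => f x (Fin.last n)) j).symm

lemma IsSiteFun.and (hd : Feature.diagonal ∈ S) (hc : Feature.meetConnection ∈ S) {m : ℕ}
    {f g : (Fin m → Bool) → Bool} (hf : IsSiteFun S f) (hg : IsSiteFun S g) :
    IsSiteFun S (fun x => f x && g x) :=
  IsSiteMap.comp (SiteMap.meetConnection hc) (IsSiteMap.append hd hf hg)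

lemma IsSiteFun.or (hd : Feature.diagonal ∈ S) (hc : Feature.joinConnection ∈ S) {m : ℕ}
    {f g : (Fin m → Bool) → Bool} (hf : IsSiteFun S f) (hg : IsSiteFun S g) :
    IsSiteFun S (fun x => f x || g x) :=
  IsSiteMap.comp (SiteMap.joinConnection hc) (IsSiteMap.append hd hf hg)

lemma IsSiteFun.not (hr : Feature.reversal ∈ S) {m : ℕ} {f : (Fin m → Bool) → Bool}
    (hf : IsSiteFun S f) : IsSiteFun S (fun x => !(f x)) :=
  IsSiteMap.comp (SiteMap.reversal hr) hf

lemma hom_surjective {X Y : Site S} (p : X ⟶ Y) [IsSplitEpi p] : Function.Surjective p.hom :=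
  fun y => ⟨(section_ p).hom y, by rw [← comp_hom_apply, IsSplitEpi.id, id_hom_apply]⟩

/-- Counting vertices makes the surjection bijective, so its section, already a map of the site, is
its inverse. -/
lemma isIso_of_dim_le {X Y : Site S} (p : X ⟶ Y) [IsSplitEpi p]
    (h : X.obj.dim ≤ Y.obj.dim) : IsIso p := by
  have hs := hom_surjective p
  have hb : Function.Bijective p.hom := (Fintype.bijective_iff_surjective_and_card _).2 ⟨hs, by
    refine le_antisymm ?_ (Fintype.card_le_of_surjective _ hs)
    simpa using Nat.pow_le_pow_right (by norm_num) h⟩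
  refine ⟨section_ p, site_hom_ext fun x => hb.1 ?_, IsSplitEpi.id p⟩
  rw [← comp_hom_apply, Category.assoc, IsSplitEpi.id]
  rfl

lemma dim_le_of_isSplitEpi {X Y : Site S} (p : X ⟶ Y) [IsSplitEpi p] :
    Y.obj.dim ≤ X.obj.dim := by
  have hs := hom_surjective p
  have := Fintype.card_le_of_surjective _ hs
  exact (Nat.pow_le_pow_iff_right one_lt_two).1 (by simpa using this)

/-! ### Sites without connections -/

/-- A literal: a constant, a variable or, if there are reversals, a negated variable. -/
def IsLiteral (S : Set Feature) {m : ℕ} (g : (Fin m → Bool) → Bool) : Prop :=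
  (∃ b, ∀ x, g x = b) ∨ ∃ (i : Fin m) (b : Bool), (b = true → Feature.reversal ∈ S) ∧
    ∀ x, g x = (x i ^^ b)

lemma isSiteFun_of_xor {m : ℕ} {i : Fin m} {b : Bool} (hb : b = true → Feature.reversal ∈ S) :
    IsSiteFun S (fun x : Fin m → Bool => (x i ^^ b)) := by
  cases b with
  | false => simpa using isSiteFun_apply i
  | true => simpa using (isSiteFun_apply i).not (hb rfl)

lemma isLiteral_of_siteMap (hm : Feature.meetConnection ∉ S) (hj : Feature.joinConnection ∉ S)
    {X Y : Cube} {f : X ⟶ Y} (hf : SiteMap S f) (j : Fin Y.dim) :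
    IsLiteral S (fun x : Fin X.dim → Bool => f x j) := by
  induction hf with
  | face ε => exact .inl ⟨ε, fun _ => rfl⟩
  | proj => exact j.elim0
  | diagonal _ n =>
    induction j using Fin.addCases with
    | left j => exact .inr ⟨j, false, by simp, fun x => by simp⟩
    | right j => exact .inr ⟨j, false, by simp, fun x =>
        (Fin.append_right x x j).trans (Bool.xor_false _).symm⟩
  | meetConnection h => exact absurd h hm
  | joinConnection h => exact absurd h hj
  | symmetry _ =>
    fin_cases j
    · exact .inr ⟨(1 : Fin 2), false, by simp, fun x => by simp⟩
    · exact .inr ⟨(0 : Fin 2), false, by simp, fun x => by simp⟩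
  | reversal h => exact .inr ⟨j, true, fun _ => h, fun x => by simp⟩
  | id X => exact .inr ⟨j, false, by simp, fun x => by simp; rfl⟩
  | comp f g _ _ ihf ihg =>
    rcases ihg j with ⟨b, hb⟩ | ⟨i, b, hb, hg⟩
    · exact .inl ⟨b, fun x => hb (f x)⟩
    · rcases ihf i with ⟨b', hb'⟩ | ⟨i', b', hb', hf⟩
      · exact .inl ⟨(b' ^^ b), fun x => (hg (f x)).trans (congrArg (· ^^ b) (hb' x))⟩
      · refine .inr ⟨i', (b' ^^ b), ?_, fun x => (hg (f x)).trans 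
          ((congrArg (· ^^ b) (hf x)).trans (Bool.xor_assoc _ _ _))⟩
        cases b' <;> cases b <;> simp_all
  | @tensor m m' n n' f g _ _ ihf ihg =>
    induction j using Fin.addCases with
    | left j =>
      rcases ihf j with ⟨b, hb⟩ | ⟨i, b, hb, hf⟩
      · exact .inl ⟨b, fun x => by simp [Cube.tensor, hb]⟩
      · exact .inr ⟨Fin.castAdd n i, b, hb, fun x => by simp [Cube.tensor, hf]⟩
    | right j =>
      rcases ihg j with ⟨b, hb⟩ | ⟨i, b, hb, hf⟩
      · exact .inl ⟨b, fun x => by simp [Cube.tensor, hb]⟩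
      · exact .inr ⟨Fin.natAdd m i, b, hb, fun x => by simp [Cube.tensor, hf]⟩

lemma site_exists_factorization (hd : Feature.diagonal ∈ S) (hm : Feature.meetConnection ∉ S)
    (hj : Feature.joinConnection ∉ S) {X Y : Site S} (f : X ⟶ Y) :
    ∃ (Z : Site S) (l : X ⟶ Z) (r : Z ⟶ Y), IsSplitEpi l ∧ IsSplitMono r ∧ l ≫ r = f := by
  classical
  have hlit := isLiteral_of_siteMap hm hj f.property
  -- The variables on which `f` depends: `l` projects onto them, and `σ` fills the others with
  -- `false`.
  let U : Finset (Fin X.obj.dim) := {i | ∃ (j : Fin Y.obj.dim) (b : Bool),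
    (b = true → Feature.reversal ∈ S) ∧ ∀ x, f.hom x j = (x i ^^ b)}
  let e : Fin U.card ≃ U := U.equivFin.symm
  have hU : ∀ t, ∃ (j : Fin Y.obj.dim) (b : Bool),
      (b = true → Feature.reversal ∈ S) ∧ ∀ x, f.hom x j = (x (e t) ^^ b) := fun t => by
    exact (Finset.mem_filter.1 (e t).2).2
  choose J B hB hJ using hU
  let s : (Fin U.card → Bool) → X.obj.Vertex := fun z i =>
    if h : i ∈ U then z (e.symm ⟨i, h⟩) else false
  have hs : ∀ z t, s z (e t) = z t := fun z t => by simp [s]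
  have hs_mem : IsSiteMap S s := isSiteMap_of_coordinates hd fun i => by
    by_cases h : i ∈ U
    · simpa [s, h] using isSiteFun_apply (e.symm ⟨i, h⟩)
    · simpa [s, h] using isSiteFun_const false
  have hl_mem : IsSiteMap S (fun (x : X.obj.Vertex) (t : Fin U.card) => x (e t)) :=
    isSiteMap_of_coordinates hd fun t => isSiteFun_apply _
  let Z : Site S := ⟨⟨U.card⟩⟩
  let l : X ⟶ Z := siteHom _ hl_mem
  let σ : Z ⟶ X := siteHom _ hs_mem
  have hσ : σ ≫ l = 𝟙 Z := site_hom_ext fun z => funext fun t => hs z t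
  have hf : l ≫ σ ≫ f = f := site_hom_ext fun x => funext fun j => by
    change f.hom (s fun t => x (e t)) j = f.hom x j
    rcases hlit j with ⟨b, hb⟩ | ⟨i, b, hb, hf⟩
    · exact (hb _).trans (hb _).symm
    · have hi : i ∈ U := Finset.mem_filter.2 ⟨Finset.mem_univ _, j, b, hb, hf⟩
      have := hs (fun t => x (e t)) (e.symm ⟨i, hi⟩)
      simp only [Equiv.apply_symm_apply] at this
      exact (hf _).trans (by rw [this]; exact (hf x).symm)
  -- The retraction reads variable `t` off a coordinate `J t` of `f`, undoing the sign `B t`.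
  have hr_mem : IsSiteMap S (fun (y : Y.obj.Vertex) (t : Fin U.card) => (y (J t) ^^ B t)) :=
    isSiteMap_of_coordinates hd fun t => isSiteFun_of_xor (hB t)
  let ρ : Y ⟶ Z := siteHom _ hr_mem
  refine ⟨Z, l, σ ≫ f, IsSplitEpi.mk' ⟨σ, hσ⟩, IsSplitMono.mk' ⟨ρ, ?_⟩, hf⟩
  refine site_hom_ext fun z => funext fun t => ?_
  change (f.hom (s z) (J t) ^^ B t) = z t
  rw [hJ, hs]
  simp

/-- A split epimorphism of a site without connections forgets some of the coordinates and
permutes and reverses the others. It has a section that sets the forgotten coordinates to `0`. -/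
lemma exists_zero_section (hd : Feature.diagonal ∈ S) (hm : Feature.meetConnection ∉ S)
    (hj : Feature.joinConnection ∉ S) {X Y : Site S} (p : X ⟶ Y) [IsSplitEpi p] :
    ∃ (i : Y ⟶ X) (U : Set (Fin X.obj.dim)), i ≫ p = 𝟙 Y ∧
      (∀ k ∈ U, ∃ (j : Fin Y.obj.dim) (b : Bool), ∀ x, p.hom x j = (x k ^^ b)) ∧
      (∀ x x', (∀ k ∈ U, x k = x' k) → p.hom x = p.hom x') ∧
      (∀ x, ∀ k ∈ U, i.hom (p.hom x) k = x k) ∧ ∀ y, ∀ k ∉ U, i.hom y k = false := by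
  classical
  have hs := hom_surjective p
  have hlit : ∀ j, ∃ (i : Fin X.obj.dim) (b : Bool), (b = true → Feature.reversal ∈ S) ∧
      ∀ x, p.hom x j = (x i ^^ b) := fun j => by
    rcases isLiteral_of_siteMap hm hj p.property j with ⟨b, hb⟩ | h
    · obtain ⟨x, hx⟩ := hs (fun _ => !b)
      have h1 := hb x
      simp [hx] at h1
    · exact h
  choose u b hb hp using hlit
  have hu : Function.Injective u := by
    intro j j' h
    by_contra hne
    -- If coordinates `j` and `j'` used the same variable, this vertex would require it to be both
    -- `false` and `true`.
    obtain ⟨x, hx⟩ := hs (fun k => if k = j then b j else !(b j'))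
    have h1 := hp j x
    have h2 := hp j' x
    rw [hx] at h1 h2
    simp only [if_true, if_neg (Ne.symm hne), ← h] at h1 h2
    cases hxj : x (u j) <;> simp [hxj] at h1 h2
  let s : Y.obj.Vertex → X.obj.Vertex :=
    fun y k => if h : ∃ j, u j = k then (y h.choose ^^ b h.choose) else false
  have hsu : ∀ y j, s y (u j) = (y j ^^ b j) := fun y j => by
    have h : ∃ j', u j' = u j := ⟨j, rfl⟩
    have h' := hu h.choose_spec
    simp only [s, dif_pos h, h']
  have hs_mem : IsSiteMap S s := isSiteMap_of_coordinates hd fun k => by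
    by_cases h : ∃ j, u j = k
    · obtain ⟨j, rfl⟩ := h
      simp only [hsu]
      exact isSiteFun_of_xor (hb j)
    · simpa only [s, dif_neg h] using isSiteFun_const false
  refine ⟨siteHom s hs_mem, Set.range u, ?_, ?_, ?_, ?_, ?_⟩
  · refine site_hom_ext fun y => funext fun j => ?_
    change p.hom (s y) j = y j
    rw [hp, hsu]
    simp
  · rintro _ ⟨j, rfl⟩
    exact ⟨j, b j, hp j⟩
  · intro x x' h
    funext j
    rw [hp, hp, h _ ⟨j, rfl⟩]
  · rintro x _ ⟨j, rfl⟩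
    change s (p.hom x) (u j) = x (u j)
    rw [hsu, hp]
    simp
  · intro y k hk
    exact dif_neg hk

theorem site_isSplitEilenbergZilber (hd : Feature.diagonal ∈ S)
    (hm : Feature.meetConnection ∉ S) (hj : Feature.joinConnection ∉ S) :
    IsSplitEilenbergZilber.{w} (Site.deg (S := S)) where
  essentiallySmall := inferInstance
  exists_factorization f := site_exists_factorization hd hm hj f
  deg_eq_of_iso := fun ⟨e⟩ => le_antisymm (dim_le_of_isSplitEpi e.inv) (dim_le_of_isSplitEpi e.hom)
  isSplitEpi_lowers {X Y} f hf hi := by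
    by_contra h
    exact hi (isIso_of_dim_le f (not_lt.1 h))
  pseudoEqual_of_pseudoSections {a b b'} p p' hp hp' h := by
    obtain ⟨i, U, hi, -, -, hU2, hU3⟩ := exists_zero_section hd hm hj p
    obtain ⟨-, U', -, hU1', hU', -, -⟩ := exists_zero_section hd hm hj p'
    have hiso : IsIso (i ≫ p') := (h _ i).1 (by unfold IsPseudoSection; rw [hi]; infer_instance)
    refine ⟨asIso (i ≫ p'), site_hom_ext fun x => hU' _ _ fun k hk => ?_⟩
    refine hU2 x k ?_
    -- If `p'` used a variable outside `U`, the zero section of `p` would make one coordinate of `i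
    -- ≫ p'` constant, contradicting surjectivity.
    by_contra hkU
    obtain ⟨j, c, hc⟩ := hU1' k hk
    have h1 := comp_hom_apply (inv (i ≫ p')) (i ≫ p') (fun _ => !c)
    rw [IsIso.inv_hom_id, id_hom_apply, comp_hom_apply] at h1
    have h2 := congrFun h1 j
    rw [hc, hU3 _ k hkU] at h2
    simp at h2
  exists_absolutePushout {a b c} p q hp hq := by
    obtain ⟨i, U, hi, -, -, hU2, hU3⟩ := exists_zero_section hd hm hj p
    obtain ⟨j, V, hj', -, -, hV2, hV3⟩ := exists_zero_section hd hm hj q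
    refine exists_absolutePushout_of_commute (site_exists_factorization hd hm hj) hi hj' ?_
    -- Both composites keep the coordinates in `U ∩ V` and set the rest to `false`.
    refine site_hom_ext fun x => funext fun k => ?_
    simp only [comp_hom_apply]
    by_cases hk : k ∈ U <;> by_cases hk' : k ∈ V <;>
      simp only [hk, hk', hU2, hU3, hV2, hV3, not_false_eq_true]

end Sites


section Connections

variable {S : Set Feature}

/-! ### Sites with connections -/

lemma exists_card_fixedPoints_eq (hC : IsIdempotentComplete (Site S)) {X : Site S} (p : X ⟶ X)
    (hp : p ≫ p = p) : ∃ k, Nat.card {x // p.hom x = x} = 2 ^ k := by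
  obtain ⟨Y, i, e, hie, hei⟩ := hC.idempotents_split X p hp
  have h1 : ∀ y, e.hom (i.hom y) = y := fun y => by rw [← comp_hom_apply, hie, id_hom_apply]
  have h2 : ∀ x, i.hom (e.hom x) = p.hom x := fun x => by rw [← comp_hom_apply, hei]
  refine ⟨Y.obj.dim, ?_⟩
  let E : {x // p.hom x = x} ≃ Y.obj.Vertex :=
    { toFun := fun x => e.hom x.1
      invFun := fun y => ⟨i.hom y, by rw [← h2, h1]⟩
      left_inv := fun x => Subtype.ext ((h2 _).trans x.2)
      right_inv := h1 }
  rw [Nat.card_congr E]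
  simp

lemma not_isIdempotentComplete_of_card {f : (Fin 2 → Bool) → Fin 2 → Bool} (hf : IsSiteMap S f)
    (hff : ∀ x, f (f x) = f x) (hcard : Fintype.card {x // f x = x} = 3) :
    ¬ IsIdempotentComplete (Site S) := by
  intro hC
  obtain ⟨k, hk⟩ := exists_card_fixedPoints_eq hC (X := ⟨⟨2⟩⟩) (siteHom f hf) (site_hom_ext hff)
  have hk' : Nat.card {x // f x = x} = 2 ^ k := hk
  rw [Nat.card_eq_fintype_card, hcard] at hk'
  rcases k with _ | _ | k
  · simp at hk'
  · simp at hk'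
  · have := Nat.one_le_two_pow (n := k)
    rw [pow_succ, pow_succ] at hk'
    omega

lemma not_isIdempotentComplete_of_meet (hd : Feature.diagonal ∈ S)
    (hc : Feature.meetConnection ∈ S) : ¬ IsIdempotentComplete (Site S) := by
  refine not_isIdempotentComplete_of_card (f := fun x => ![x 0, x 0 && x 1])
    (isSiteMap_of_coordinates hd fun j => ?_) (by decide) (by decide)
  fin_cases j
  · exact isSiteFun_apply 0
  · exact (isSiteFun_apply 0).and hd hc (isSiteFun_apply 1)

lemma not_isIdempotentComplete_of_join (hd : Feature.diagonal ∈ S)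
    (hc : Feature.joinConnection ∈ S) : ¬ IsIdempotentComplete (Site S) := by
  refine not_isIdempotentComplete_of_card (f := fun x => ![x 0, x 0 || x 1])
    (isSiteMap_of_coordinates hd fun j => ?_) (by decide) (by decide)
  fin_cases j
  · exact isSiteFun_apply 0
  · exact (isSiteFun_apply 0).or hd hc (isSiteFun_apply 1)

/-- The maps of a cubical site preserve every relation that contains the constants and is closed
under the connections and the reversal of the site. -/
lemma SiteMap.preserves {ι : Type*} {R : (ι → Bool) → Prop} (hconst : ∀ ε, R fun _ => ε)
    (hmeet : Feature.meetConnection ∈ S → ∀ x y, R x → R y → R fun a => x a && y a)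
    (hjoin : Feature.joinConnection ∈ S → ∀ x y, R x → R y → R fun a => x a || y a)
    (hrev : Feature.reversal ∈ S → ∀ x, R x → R fun a => !(x a))
    {X Y : Cube} {f : X ⟶ Y} (hf : SiteMap S f) (x : ι → X.Vertex)
    (hx : ∀ i, R fun a => x a i) (j : Fin Y.dim) : R fun a => (f : X.Vertex → Y.Vertex) (x a) j := by
  induction hf with
  | face ε => exact hconst ε
  | proj => exact j.elim0
  | diagonal _ n =>
    induction j using Fin.addCases with
    | left j => simpa only [Fin.append_left] using hx j
    | right j => simpa only [Fin.append_right] using hx j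
  | meetConnection h => exact hmeet h _ _ (hx (0 : Fin 2)) (hx (1 : Fin 2))
  | joinConnection h => exact hjoin h _ _ (hx (0 : Fin 2)) (hx (1 : Fin 2))
  | symmetry _ =>
    fin_cases j
    · exact hx (1 : Fin 2)
    · exact hx (0 : Fin 2)
  | reversal h => exact hrev h _ (hx j)
  | id X => exact hx j
  | comp f g _ _ ihf ihg => exact ihg _ (ihf x hx) j
  | @tensor m m' n n' f g _ _ ihf ihg =>
    induction j using Fin.addCases with
    | left j =>
      simp only [Cube.tensor, Fin.append_left]
      exact ihf _ (fun i => hx (Fin.castAdd n i)) j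
    | right j =>
      simp only [Cube.tensor, Fin.append_right]
      exact ihg _ (fun i => hx (Fin.natAdd m i)) j

/-- The preserved relation is the graph of conjunction. -/
lemma IsSiteMap.apply_and (hj : Feature.joinConnection ∉ S) (hr : Feature.reversal ∉ S) {m n : ℕ}
    {f : (Fin m → Bool) → Fin n → Bool} (hf : IsSiteMap S f) (x y : Fin m → Bool) (j : Fin n) :
    f (fun i => x i && y i) j = (f x j && f y j) := by
  refine SiteMap.preserves (R := fun z : Fin 3 → Bool => z 2 = (z 0 && z 1)) (by simp)
    (fun _ a b ha hb => ?_) (fun h => absurd h hj) (fun h => absurd h hr) hf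
    ![x, y, fun i => x i && y i] (fun i => rfl) j
  simp only [ha, hb]
  ac_rfl

lemma IsSiteMap.apply_or (hm : Feature.meetConnection ∉ S) (hr : Feature.reversal ∉ S) {m n : ℕ}
    {f : (Fin m → Bool) → Fin n → Bool} (hf : IsSiteMap S f) (x y : Fin m → Bool) (j : Fin n) :
    f (fun i => x i || y i) j = (f x j || f y j) := by
  refine SiteMap.preserves (R := fun z : Fin 3 → Bool => z 2 = (z 0 || z 1)) (by simp)
    (fun h => absurd h hm) (fun _ a b ha hb => ?_) (fun h => absurd h hr) hf
    ![x, y, fun i => x i || y i] (fun i => rfl) j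
  simp only [ha, hb]
  ac_rfl

lemma IsSiteMap.monotone (hr : Feature.reversal ∉ S) {m n : ℕ}
    {f : (Fin m → Bool) → Fin n → Bool} (hf : IsSiteMap S f) : Monotone f := by
  intro x y h j
  refine SiteMap.preserves (R := fun z : Fin 2 → Bool => z 0 ≤ z 1) (fun _ => le_rfl)
    (fun _ a b ha hb => inf_le_inf ha hb) (fun _ a b ha hb => sup_le_sup ha hb)
    (fun h => absurd h hr) hf ![x, y] h j

lemma IsOrthogonalFactorizationSystem.exists_siteMap
    {R : MorphismProperty (Idempotents.Karoubi (Site S))}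
    (h : IsOrthogonalFactorizationSystem (splitEpis (Idempotents.Karoubi (Site S))) R)
    {m n : ℕ} {f : (Fin m → Bool) → Fin n → Bool} (hf : IsSiteMap S f) :
    ∃ e : (Fin m → Bool) → Fin m → Bool, IsSiteMap S e ∧ (∀ x, f (e x) = f x) ∧
      ∀ {k : ℕ} {a : (Fin k → Bool) → Fin m → Bool} {ε : (Fin k → Bool) → Fin k → Bool},
        IsSiteMap S a → IsSiteMap S ε → (∀ x, ε (ε x) = ε x) →
        (∀ x, f (a (ε x)) = f (a x)) → ∀ x, e (a (ε x)) = e (a x) := by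
  obtain ⟨e, h1, h2⟩ := h.exists_endomorphism (X := ⟨⟨m⟩⟩) (Y := ⟨⟨n⟩⟩) (siteHom f hf)
  refine ⟨e.hom, isSiteMap_hom e, fun x => congrArg (fun g => g.hom x) h1, ?_⟩
  intro k a ε ha hε hεε hεf x
  exact congrArg (fun g => g.hom x) (h2 ⟨⟨k⟩⟩ (siteHom a ha) (siteHom ε hε)
    (site_hom_ext hεε) (site_hom_ext hεf))

/-- If all maps of a site preserve one of the connections, then in its Karoubi envelope the split
epimorphisms are not the left class of an orthogonal factorization system: the joint coequalizer
of two idempotents can be a nondistributive semilattice. -/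
lemma not_splitEpis_of_preserves {op : Bool → Bool → Bool} {u : Bool}
    (hop : (op = and ∧ u = true) ∨ (op = or ∧ u = false)) (hd : Feature.diagonal ∈ S)
    (hfun : ∀ {m : ℕ} {f g : (Fin m → Bool) → Bool}, IsSiteFun S f → IsSiteFun S g →
      IsSiteFun S (fun x => op (f x) (g x)))
    (hpres : ∀ {m : ℕ} {f : (Fin m → Bool) → Fin m → Bool}, IsSiteMap S f →
      ∀ (x y : Fin m → Bool) (j : Fin m),
      f (fun i => op (x i) (y i)) j = op (f x j) (f y j)) :
    ¬ ∃ R : MorphismProperty (Idempotents.Karoubi (Site S)),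
      IsOrthogonalFactorizationSystem (splitEpis (Idempotents.Karoubi (Site S))) R := by
  rintro ⟨R, h⟩
  have hv (i : Fin 4) : IsSiteFun S (fun x => x i) := isSiteFun_apply i
  -- The five values of this map form a pentagon under `op`. The idempotents below do not change
  -- `f`.
  have hf : IsSiteMap S (fun x : Fin 4 → Bool =>
      ![op (x 0) (x 1), op (op (x 0) (x 1)) (x 2), op (op (x 1) (x 2)) (x 3)]) :=
    isSiteMap_of_coordinates hd fun j => by
      fin_cases j
      · exact hfun (hv 0) (hv 1)
      · exact hfun (hfun (hv 0) (hv 1)) (hv 2)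
      · exact hfun (hfun (hv 1) (hv 2)) (hv 3)
  have hε₁ : IsSiteMap S (fun x : Fin 4 → Bool =>
      ![op (x 0) (x 1), u, x 2, op (op (x 1) (x 2)) (x 3)]) :=
    isSiteMap_of_coordinates hd fun j => by
      fin_cases j
      · exact hfun (hv 0) (hv 1)
      · exact isSiteFun_const u
      · exact hv 2
      · exact hfun (hfun (hv 1) (hv 2)) (hv 3)
  have hε₂ : IsSiteMap S (fun x : Fin 4 → Bool =>
      ![op (x 0) (x 1), u, op (x 1) (x 2), op (op (x 1) (x 2)) (x 3)]) :=
    isSiteMap_of_coordinates hd fun j => by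
      fin_cases j
      · exact hfun (hv 0) (hv 1)
      · exact isSiteFun_const u
      · exact hfun (hv 1) (hv 2)
      · exact hfun (hfun (hv 1) (hv 2)) (hv 3)
  obtain ⟨e, he, hef, hinv⟩ := h.exists_siteMap hf
  -- For `op = and`, the vertex 0010 goes to 0110 under the first idempotent and to 0100 under the
  -- second, so `e` agrees on these two. But 0110 is the meet of 1110 and 0111, where `f ∘ e = f`
  -- forces coordinate 2 of `e` to be 1, while 0100 lies below 1100, where it is 0. The case of `or`
  -- is dual.
  have h₁ := hinv (isSiteMap_id 4) hε₁ (by rcases hop with ⟨rfl, rfl⟩ | ⟨rfl, rfl⟩ <;> decide)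
    (by rcases hop with ⟨rfl, rfl⟩ | ⟨rfl, rfl⟩ <;> decide) ![!u, !u, u, !u]
  have h₂ := hinv (isSiteMap_id 4) hε₂ (by rcases hop with ⟨rfl, rfl⟩ | ⟨rfl, rfl⟩ <;> decide)
    (by rcases hop with ⟨rfl, rfl⟩ | ⟨rfl, rfl⟩ <;> decide) ![!u, !u, u, !u]
  have hM := hpres he ![u, u, u, !u] ![!u, u, u, u] 2
  have hN := hpres he ![u, u, !u, !u] ![!u, u, !u, !u] 2
  have hP := congrFun (hef ![u, u, u, !u]) 1
  have hQ := congrFun (hef ![!u, u, u, u]) 2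
  have hA := hef ![u, u, !u, !u]
  have hA0 := congrFun hA 0
  have hA1 := congrFun hA 1
  have hM' : (fun i => op ((![u, u, u, !u] : Fin 4 → Bool) i)
      ((![!u, u, u, u] : Fin 4 → Bool) i)) = ![!u, u, u, !u] := by
    rcases hop with ⟨rfl, rfl⟩ | ⟨rfl, rfl⟩ <;> decide
  have hN' : (fun i => op ((![u, u, !u, !u] : Fin 4 → Bool) i)
      ((![!u, u, !u, !u] : Fin 4 → Bool) i)) = ![!u, u, !u, !u] := by
    rcases hop with ⟨rfl, rfl⟩ | ⟨rfl, rfl⟩ <;> decide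
  rw [hM'] at hM
  rw [hN'] at hN
  clear hM' hN' hef hinv hpres hfun hA
  rcases hop with ⟨rfl, rfl⟩ | ⟨rfl, rfl⟩ <;> simp at h₁ h₂ hM hN hP hQ hA0 hA1 <;>
    rw [h₁, ← h₂] at hM <;> simp_all

/-- If a site has both connections and no reversals, then in its Karoubi envelope the split
epimorphisms are not the left class of an orthogonal factorization system: a monotone map onto a
chain need not have a monotone section. -/
lemma not_splitEpis_of_meet_of_join (hd : Feature.diagonal ∈ S)
    (hm : Feature.meetConnection ∈ S) (hj : Feature.joinConnection ∈ S)
    (hr : Feature.reversal ∉ S) :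
    ¬ ∃ R : MorphismProperty (Idempotents.Karoubi (Site S)),
      IsOrthogonalFactorizationSystem (splitEpis (Idempotents.Karoubi (Site S))) R := by
  rintro ⟨R, h⟩
  have hv {m : ℕ} (i : Fin m) : IsSiteFun S (fun x => x i) := isSiteFun_apply i
  -- The fibres over the five-element chain are {000, 010}, {100}, {001, 110}, {101, 011}, {111}; no
  -- monotone section exists, as 100 lies below only 110 in the third, and 110 below nothing in the
  -- fourth.
  have hf : IsSiteMap S (fun x : Fin 3 → Bool =>
      ![x 0 || x 2, x 2 || x 0 && x 1, x 2 && (x 0 || x 1), x 0 && x 1 && x 2]) :=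
    isSiteMap_of_coordinates hd fun j => by
      fin_cases j
      · exact (hv 0).or hd hj (hv 2)
      · exact (hv 2).or hd hj ((hv 0).and hd hm (hv 1))
      · exact (hv 2).and hd hm ((hv 0).or hd hj (hv 1))
      · exact ((hv 0).and hd hm (hv 1)).and hd hm (hv 2)
  have ha₁ : IsSiteMap S (fun x : Fin 2 → Bool => ![x 0, x 0, x 1]) :=
    isSiteMap_of_coordinates hd fun j => by
      fin_cases j
      · exact hv 0
      · exact hv 0
      · exact hv 1
  have ha₂ : IsSiteMap S (fun x : Fin 2 → Bool => ![x 0, x 1, true]) :=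
    isSiteMap_of_coordinates hd fun j => by
      fin_cases j
      · exact hv 0
      · exact hv 1
      · exact isSiteFun_const true
  -- Sorting two coordinates identifies 110 with 001 along the first map and 101 with 011 along the
  -- second.
  have hε : IsSiteMap S (fun x : Fin 2 → Bool => ![x 0 && x 1, x 0 || x 1]) :=
    isSiteMap_of_coordinates hd fun j => by
      fin_cases j
      · exact (hv 0).and hd hm (hv 1)
      · exact (hv 0).or hd hj (hv 1)
  obtain ⟨e, he, hef, hinv⟩ := h.exists_siteMap hf
  -- Monotonicity from 100 forces `e` to send 110 to itself, hence also 001. Then `e` sends 011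
  -- above 110, but to a vertex of {101, 011}.
  have h₁ := hinv ha₁ hε (by decide) (by decide) ![true, false]
  have h₂ := hinv ha₂ hε (by decide) (by decide) ![true, false]
  have m₁ := he.monotone hr (a := ![true, false, false]) (b := ![true, true, false])
    (fun i => by fin_cases i <;> simp) 0
  have m₂ := he.monotone hr (a := ![false, false, true]) (b := ![false, true, true])
    (fun i => by fin_cases i <;> simp)
  have m₂0 := m₂ 0
  have m₂1 := m₂ 1
  have f0 := congrFun (hef ![true, false, false]) 0
  have f1 := congrFun (hef ![true, false, false]) 1
  have g1 := congrFun (hef ![true, true, false]) 1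
  have g2 := congrFun (hef ![true, true, false]) 2
  have k2 := congrFun (hef ![false, true, true]) 2
  have k3 := congrFun (hef ![false, true, true]) 3
  clear hinv hef m₂
  simp at h₁ h₂ f0 f1 g1 g2 k2 k3
  rw [h₁] at m₂0 m₂1
  rw [Bool.le_iff_imp] at m₁ m₂0 m₂1
  simp_all

end Connections

/-! ### Finite nonempty sets -/

namespace FinNonempty

/-- A map of sets as a morphism of finite nonempty sets. -/
def ofFun {X Y : FinNonempty} (f : X.obj → Y.obj) : X ⟶ Y :=
  ObjectProperty.homMk (TypeCat.ofHom f)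

lemma comp_apply {X Y Z : FinNonempty} (f : X ⟶ Y) (g : Y ⟶ Z) (x : X.obj) :
    (f ≫ g).hom x = g.hom (f.hom x) := rfl

lemma id_apply (X : FinNonempty) (x : X.obj) : (𝟙 X : X ⟶ X).hom x = x := rfl

lemma hom_ext {X Y : FinNonempty} {f g : X ⟶ Y} (h : ∀ x, f.hom x = g.hom x) : f = g :=
  ObjectProperty.hom_ext _ (ConcreteCategory.hom_ext _ _ h)

lemma surjective_of_isSplitEpi {X Y : FinNonempty} (f : X ⟶ Y) [IsSplitEpi f] :
    Function.Surjective f.hom :=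
  fun y => ⟨(section_ f).hom y, by rw [← comp_apply, IsSplitEpi.id, id_apply]⟩

lemma isSplitEpi_of_surjective {X Y : FinNonempty} {f : X ⟶ Y}
    (h : Function.Surjective f.hom) : IsSplitEpi f :=
  .mk' ⟨ofFun (Function.surjInv h), hom_ext (Function.surjInv_eq h)⟩

lemma bijective_of_isIso {X Y : FinNonempty} (f : X ⟶ Y) [IsIso f] :
    Function.Bijective f.hom := by
  refine ⟨fun x x' h => ?_, surjective_of_isSplitEpi f⟩
  have := congrArg (inv f).hom h
  rwa [← comp_apply, ← comp_apply, IsIso.hom_inv_id, id_apply, id_apply] at this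

lemma isIso_of_bijective {X Y : FinNonempty} {f : X ⟶ Y} (h : Function.Bijective f.hom) :
    IsIso f := by
  let E := Equiv.ofBijective _ h
  exact ⟨ofFun E.symm, hom_ext E.symm_apply_apply, hom_ext E.apply_symm_apply⟩

lemma exists_factorization {X Y : FinNonempty} (f : X ⟶ Y) :
    ∃ (Z : FinNonempty) (l : X ⟶ Z) (r : Z ⟶ Y), IsSplitEpi l ∧ IsSplitMono r ∧ l ≫ r = f := by
  have := X.property.1
  have := X.property.2
  let Z : FinNonempty := ⟨Set.range f.hom, inferInstance, inferInstance⟩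
  let r : Z ⟶ Y := ofFun Subtype.val
  refine ⟨Z, ofFun (Set.rangeFactorization f.hom), r,
    isSplitEpi_of_surjective Set.rangeFactorization_surjective, ?_, rfl⟩
  -- Nonemptiness provides the value of the retraction off the image.
  exact .mk' ⟨ofFun (Function.invFun (Subtype.val : Set.range f.hom → Y.obj)),
    hom_ext (Function.leftInverse_invFun Subtype.val_injective)⟩

lemma exists_section {a b : FinNonempty} {p : a ⟶ b} (hp : Function.Surjective p.hom)
    {x y : a.obj} (hxy : p.hom x ≠ p.hom y) :
    ∃ i : b ⟶ a, i ≫ p = 𝟙 b ∧ i.hom (p.hom x) = x ∧ i.hom (p.hom y) = y := by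
  classical
  let f : b.obj → a.obj := fun z =>
    if z = p.hom x then x else if z = p.hom y then y else Function.surjInv hp z
  refine ⟨ofFun f, hom_ext fun z => ?_, if_pos rfl, (if_neg hxy.symm).trans (if_pos rfl)⟩
  change p.hom (f z) = z
  by_cases h : z = p.hom x
  · rw [show f z = x from if_pos h, h]
  · by_cases h' : z = p.hom y
    · rw [show f z = y from (if_neg h).trans (if_pos h'), h']
    · simp only [f, if_neg h, if_neg h']
      exact Function.surjInv_eq hp z

/-- The absolute pushout of a surjection along the identification of two points. -/
lemma exists_merge {a b : FinNonempty} (p : a ⟶ b) (hp : Function.Surjective p.hom) {y w : a.obj}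
    (hyw : y ≠ w) :
    ∃ (a' : FinNonempty) (q : a ⟶ a') (d : FinNonempty) (r : b ⟶ d) (s : a' ⟶ d),
      Nat.card a'.obj < Nat.card a.obj ∧
      (∀ (c : FinNonempty) (q' : a ⟶ c), q'.hom y = q'.hom w → ∃ q'' : a' ⟶ c, q ≫ q'' = q') ∧
      Function.Surjective s.hom ∧ IsAbsolutePushout.{w} p q r s := by
  classical
  have := a.property.1
  have := b.property.1
  let a' : FinNonempty := ⟨{x : a.obj // x ≠ w}, inferInstance, ⟨⟨y, hyw⟩⟩⟩
  let q : a ⟶ a' := ofFun fun x => if h : x = w then ⟨y, hyw⟩ else ⟨x, h⟩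
  let j : a' ⟶ a := ofFun Subtype.val
  have hj : j ≫ q = 𝟙 a' := hom_ext fun x => dif_neg x.2
  have hqw : q.hom w = ⟨y, hyw⟩ := dif_pos rfl
  have hqy : q.hom y = ⟨y, hyw⟩ := dif_neg hyw
  have hq : ∀ (c : FinNonempty) (q' : a ⟶ c), q'.hom y = q'.hom w → q ≫ j ≫ q' = q' := by
    intro c q' h
    refine hom_ext fun x => ?_
    by_cases hx : x = w
    · subst hx
      simp only [comp_apply, hqw]
      exact h
    · simp only [comp_apply, show q.hom x = ⟨x, hx⟩ from dif_neg hx]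
      rfl
  have hcard : Nat.card a'.obj < Nat.card a.obj :=
    Finite.card_subtype_lt (x := w) (by simp)
  -- If `p` already merges the two points, `b` is unchanged; otherwise `p.hom w` is merged into
  -- `p.hom y`.
  by_cases hpyw : p.hom y = p.hom w
  · have := isSplitEpi_of_surjective hp
    have h1 := hq _ p hpyw
    have h2 : (section_ p ≫ q) ≫ j ≫ p = 𝟙 b := by rw [Category.assoc, h1, IsSplitEpi.id]
    refine ⟨a', q, b, 𝟙 b, j ≫ p, hcard, fun c q' h => ⟨_, hq c q' h⟩, ?_,
      .of_splitting (i := section_ p) (j := j) (k := section_ p ≫ q) ?_ ?_ hj h2 ?_⟩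
    · have : IsSplitEpi (j ≫ p) := .mk' ⟨_, h2⟩
      exact surjective_of_isSplitEpi _
    · rw [h1, Category.comp_id]
    · simp
    · simp
  · let d : FinNonempty := ⟨{z : b.obj // z ≠ p.hom w}, inferInstance, ⟨⟨p.hom y, hpyw⟩⟩⟩
    let r : b ⟶ d := ofFun fun z => if h : z = p.hom w then ⟨p.hom y, hpyw⟩ else ⟨z, h⟩
    let t : d ⟶ b := ofFun Subtype.val
    have ht : t ≫ r = 𝟙 d := hom_ext fun z => dif_neg z.2
    have hrw : r.hom (p.hom w) = ⟨p.hom y, hpyw⟩ := dif_pos rfl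
    have hry : r.hom (p.hom y) = ⟨p.hom y, hpyw⟩ := dif_neg hpyw
    -- The section must pass through both `y` and `w`, so that `i ≫ q` takes equal values at the two
    -- points merged by `r`.
    obtain ⟨i, hi, hiy, hiw⟩ := exists_section hp hpyw
    have h1 : q ≫ j ≫ p ≫ r = p ≫ r := hq _ (p ≫ r) (by rw [comp_apply, comp_apply, hrw, hry])
    have hk : (t ≫ i ≫ q) ≫ j ≫ p ≫ r = 𝟙 d := by
      simp only [Category.assoc]
      rw [h1, reassoc_of% hi, ht]
    refine ⟨a', q, d, r, j ≫ p ≫ r, hcard, fun c q' h => ⟨_, hq c q' h⟩, ?_,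
      .of_splitting (i := i) (j := j) (k := t ≫ i ≫ q) h1.symm hi hj hk ?_⟩
    · have : IsSplitEpi (j ≫ p ≫ r) := .mk' ⟨_, hk⟩
      exact surjective_of_isSplitEpi _
    · refine hom_ext fun z => ?_
      by_cases h : z = p.hom w
      · subst h
        change q.hom (i.hom (r.hom (p.hom w)).1) = q.hom (i.hom (p.hom w))
        rw [hrw, hiw, hqw]
        change q.hom (i.hom (p.hom y)) = _
        rw [hiy, hqy]
      · simp only [comp_apply, show r.hom z = ⟨z, h⟩ from dif_neg h]
        rfl

/-- Split off from `q` one merger of two points and paste its pushout square with the one given by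
induction on the size of `a`. -/
lemma exists_absolutePushout {a b c : FinNonempty} (p : a ⟶ b) (q : a ⟶ c)
    (hp : Function.Surjective p.hom) (hq : Function.Surjective q.hom) :
    ∃ (d : FinNonempty) (r : b ⟶ d) (s : c ⟶ d), IsAbsolutePushout.{w} p q r s := by
  induction hn : Nat.card a.obj using Nat.strong_induction_on generalizing a b with
  | _ n ih =>
    by_cases hinj : Function.Injective q.hom
    · have := isSplitEpi_of_surjective hp
      have := isIso_of_bijective ⟨hinj, hq⟩
      exact ⟨b, 𝟙 b, inv q ≫ p, .of_splitting (i := section_ p) (j := inv q)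
        (k := section_ p ≫ q) (by simp) (by simp) (by simp) (by simp) (by simp)⟩
    · obtain ⟨y, w, h, hyw⟩ : ∃ y w, q.hom y = q.hom w ∧ y ≠ w := by
        simpa [Function.Injective] using hinj
      obtain ⟨a', q₁, d₁, r₁, s₁, hcard, hfac, hs₁, H₁⟩ := exists_merge p hp hyw
      obtain ⟨q₂, rfl⟩ := hfac c q h
      have hq₂ : Function.Surjective q₂.hom := fun z => by
        obtain ⟨x, hx⟩ := hq z
        exact ⟨q₁.hom x, hx⟩
      obtain ⟨d, r, s, H₂⟩ := ih _ (hn ▸ hcard) s₁ q₂ hs₁ hq₂ rfl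
      exact ⟨d, r₁ ≫ r, s, H₁.paste H₂⟩

theorem isSplitEilenbergZilber (h : EssentiallySmall.{0} FinNonempty) :
    IsSplitEilenbergZilber.{w} FinNonempty.deg where
  essentiallySmall := h
  exists_factorization f := exists_factorization f
  deg_eq_of_iso := fun ⟨e⟩ => Nat.card_eq_of_bijective _ (bijective_of_isIso e.hom)
  isSplitEpi_lowers {X Y} f hf hi := by
    have := X.property.1
    by_contra hlt
    exact hi (isIso_of_bijective
      ((surjective_of_isSplitEpi f).bijective_of_nat_card_le (not_lt.1 hlt)))
  pseudoEqual_of_pseudoSections {a b b'} p p' hp hp' h := by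
    have hp'' := surjective_of_isSplitEpi p'
    have key : ∀ x y, p.hom x = p.hom y → p'.hom x = p'.hom y := by
      intro x y hxy
      by_contra hne
      -- A section of `p'` through two points identified by `p` cannot be a pseudo-section of `p`.
      obtain ⟨i, hi, hix, hiy⟩ := exists_section hp'' hne
      have hiso : IsIso (i ≫ p) :=
        (h _ i).2 (by unfold IsPseudoSection; rw [hi]; infer_instance)
      exact hne ((bijective_of_isIso (i ≫ p)).1 (by rw [comp_apply, comp_apply, hix, hiy, hxy]))
    have hiso : IsIso (section_ p ≫ p') :=
      (h _ _).1 (by unfold IsPseudoSection; rw [IsSplitEpi.id]; infer_instance)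
    refine ⟨asIso (section_ p ≫ p'), hom_ext fun x => key _ _ ?_⟩
    exact congrArg (fun g : a ⟶ b => g.hom x) (by simp : p ≫ section_ p ≫ p = p)
  exists_absolutePushout p q hp hq :=
    exists_absolutePushout p q (surjective_of_isSplitEpi p) (surjective_of_isSplitEpi q)

end FinNonempty

/-! ### The site with all structure maps -/

section Full

variable {S : Set Feature}

/-- Case distinction on the first variable: `g` is the join of `x 0 ∧ g(1, ·)` and `¬ x 0 ∧ g(0,
·)`. -/
lemma isSiteFun_of_all (hd : Feature.diagonal ∈ S) (hm : Feature.meetConnection ∈ S)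
    (hj : Feature.joinConnection ∈ S) (hr : Feature.reversal ∈ S) {m : ℕ}
    (g : (Fin m → Bool) → Bool) : IsSiteFun S g := by
  induction m with
  | zero =>
    rw [show g = fun _ => g Fin.elim0 from funext fun x => congrArg g (Subsingleton.elim _ _)]
    exact isSiteFun_const _
  | succ m ih =>
    have htail : IsSiteMap S (fun (x : Fin (m + 1) → Bool) (i : Fin m) => x i.succ) :=
      isSiteMap_of_coordinates hd fun i => isSiteFun_apply _
    have h0 := isSiteFun_apply (S := S) (0 : Fin (m + 1))
    have hg (b : Bool) := (ih fun y => g (Fin.cons b y)).comp htail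
    have h := (h0.and hd hm (hg true)).or hd hj ((h0.not hr).and hd hm (hg false))
    unfold IsSiteFun at h ⊢
    convert h using 3 with x j
    have hx := Fin.cons_self_tail x
    unfold Fin.tail at hx
    cases hx0 : x 0 <;> rw [hx0] at hx <;> simp [hx, hx0]

lemma isSiteMap_of_all (hd : Feature.diagonal ∈ S) (hm : Feature.meetConnection ∈ S)
    (hj : Feature.joinConnection ∈ S) (hr : Feature.reversal ∈ S) {m n : ℕ}
    (f : (Fin m → Bool) → Fin n → Bool) : IsSiteMap S f :=
  isSiteMap_of_coordinates hd fun _ => isSiteFun_of_all hd hm hj hr _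

lemma karoubi_p_apply {P Q : Idempotents.Karoubi (Site S)} (f : P ⟶ Q) (x : P.X.obj.Vertex) :
    f.f.hom (P.p.hom x) = f.f.hom x := by
  rw [← comp_hom_apply, Idempotents.Karoubi.p_comp]

lemma karoubi_apply_p {P Q : Idempotents.Karoubi (Site S)} (f : P ⟶ Q) (x : P.X.obj.Vertex) :
    Q.p.hom (f.f.hom x) = f.f.hom x := by
  rw [← comp_hom_apply, Idempotents.Karoubi.comp_p]

/-- The functor from the Karoubi envelope of a cubical site to finite nonempty sets that sends a
formal retract of a cube to its set of vertices. -/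
def fixedPointFunctor (S : Set Feature) : Idempotents.Karoubi (Site S) ⥤ FinNonempty where
  obj P := ⟨{x : P.X.obj.Vertex // P.p.hom x = x}, inferInstance,
    ⟨⟨P.p.hom fun _ => false, by rw [← comp_hom_apply, P.idem]⟩⟩⟩
  map f := FinNonempty.ofFun fun x => ⟨f.f.hom x.1, karoubi_apply_p f x.1⟩
  map_id P := FinNonempty.hom_ext fun x => Subtype.ext x.2
  map_comp f g := rfl

/-- On cubes, `fixedPointFunctor` is the functor of vertices. -/
def toKaroubiCompFixedPointFunctor (S : Set Feature) :
    Idempotents.toKaroubi (Site S) ⋙ fixedPointFunctor S ≅ vertexFunctor S :=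
  NatIso.ofComponents
    (fun _ =>
      { hom := FinNonempty.ofFun fun x => x.1
        inv := FinNonempty.ofFun fun x => ⟨x, rfl⟩
        hom_inv_id := rfl
        inv_hom_id := rfl })
    (fun _ => rfl)

instance : (fixedPointFunctor S).Faithful where
  map_injective {P Q} f g h := by
    refine Idempotents.Karoubi.hom_ext _ _ (site_hom_ext fun x => ?_)
    have hx : P.p.hom (P.p.hom x) = P.p.hom x := by rw [← comp_hom_apply, P.idem]
    have := congrArg (fun k => (k.hom ⟨P.p.hom x, hx⟩).1) h
    exact ((karoubi_p_apply f x).symm.trans this).trans (karoubi_p_apply g x)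

lemma fixedPointFunctor_isEquivalence (hd : Feature.diagonal ∈ S)
    (hm : Feature.meetConnection ∈ S) (hj : Feature.joinConnection ∈ S)
    (hr : Feature.reversal ∈ S) : (fixedPointFunctor S).IsEquivalence where
  full := ⟨fun {P Q} g => by
    have hx : ∀ x, P.p.hom (P.p.hom x) = P.p.hom x := fun x => by
      rw [← comp_hom_apply, P.idem]
    let f : P.X ⟶ Q.X := siteHom (fun x => (g.hom ⟨P.p.hom x, hx x⟩).1)
      (isSiteMap_of_all hd hm hj hr _)
    refine ⟨⟨f, site_hom_ext fun x => ?_⟩, FinNonempty.hom_ext fun x => Subtype.ext ?_⟩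
    · change Q.p.hom (g.hom ⟨P.p.hom (P.p.hom x), _⟩).1 = (g.hom ⟨P.p.hom x, _⟩).1
      refine Eq.trans (g.hom ⟨P.p.hom (P.p.hom x), hx _⟩).2 ?_
      simp only [hx]
    · change (g.hom ⟨P.p.hom x.1, _⟩).1 = (g.hom x).1
      simp only [x.2]
      rfl⟩
  essSurj := ⟨fun A => by
    classical
    have := A.property.1
    have := A.property.2
    let E := Finite.equivFin A.obj
    -- One-hot encoding makes `A` a retract of a cube.
    let ι : A.obj → Fin (Nat.card A.obj) → Bool := fun x i => decide (E x = i)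
    have hι : Function.Injective ι := fun x y h => by
      have := congrFun h (E y)
      simpa [ι] using this
    have hret := Function.leftInverse_invFun hι
    let X : Site S := ⟨⟨Nat.card A.obj⟩⟩
    let p : X ⟶ X := siteHom (fun z => ι (Function.invFun ι z)) (isSiteMap_of_all hd hm hj hr _)
    let P : Idempotents.Karoubi (Site S) :=
      ⟨X, p, site_hom_ext fun z => congrArg ι (hret _)⟩
    exact ⟨P, ⟨{ hom := FinNonempty.ofFun fun z => Function.invFun ι z.1
                 inv := FinNonempty.ofFun fun x => ⟨ι x, congrArg ι (hret x)⟩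
                 hom_inv_id := FinNonempty.hom_ext fun z => Subtype.ext z.2
                 inv_hom_id := FinNonempty.hom_ext hret }⟩⟩⟩

end Full

end EZCubes

theorem mainTheorem5 :
    -- diagonals and symmetries, with or without reversals
    (∀ S ∈ ({{.diagonal, .symmetry},
             {.diagonal, .symmetry, .reversal}} : Set (Set EZCubes.Feature)),
      ∃ L R : MorphismProperty (EZCubes.Site S),
        EZCubes.IsStronglySkeletal EZCubes.Site.deg L R ∧
        EZCubes.IsEilenbergZilber.{w} EZCubes.Site.deg L R) ∧
    -- diagonals, symmetries and one or both connections
    (∀ S ∈ ({{.diagonal, .meetConnection, .symmetry},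
             {.diagonal, .joinConnection, .symmetry},
             {.diagonal, .meetConnection, .joinConnection, .symmetry}} :
              Set (Set EZCubes.Feature)),
      ¬ IsIdempotentComplete (EZCubes.Site S) ∧
      (¬ ∃ (deg : EZCubes.Site S → ℕ) (L R : MorphismProperty (EZCubes.Site S)),
        EZCubes.IsGeneralizedReedy deg L R) ∧
      (¬ ∃ R : MorphismProperty (Idempotents.Karoubi (EZCubes.Site S)),
        EZCubes.IsOrthogonalFactorizationSystem
          (EZCubes.splitEpis (Idempotents.Karoubi (EZCubes.Site S))) R) ∧
      (¬ ∃ (deg : Idempotents.Karoubi (EZCubes.Site S) → ℕ)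
          (L R : MorphismProperty (Idempotents.Karoubi (EZCubes.Site S))),
        EZCubes.IsEilenbergZilber.{w} deg L R)) ∧
    -- diagonals, connections, symmetries and reversals
    (∀ S : Set EZCubes.Feature,
      S = {.diagonal, .meetConnection, .joinConnection, .symmetry, .reversal} →
      ¬ IsIdempotentComplete (EZCubes.Site S) ∧
      (¬ ∃ (deg : EZCubes.Site S → ℕ) (L R : MorphismProperty (EZCubes.Site S)),
        EZCubes.IsGeneralizedReedy deg L R) ∧
      -- the idempotent completion is the category of finite nonempty sets
      (∃ e : Idempotents.Karoubi (EZCubes.Site S) ≌ EZCubes.FinNonempty,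
        Nonempty (Idempotents.toKaroubi (EZCubes.Site S) ⋙ e.functor ≅ EZCubes.vertexFunctor S) ∧
        ∃ L R : MorphismProperty (Idempotents.Karoubi (EZCubes.Site S)),
          EZCubes.IsStronglySkeletal (fun X => (e.functor.obj X).deg) L R ∧
          EZCubes.IsEilenbergZilber.{w} (fun X => (e.functor.obj X).deg) L R) ∧
      (∃ L R : MorphismProperty EZCubes.FinNonempty,
        EZCubes.IsStronglySkeletal EZCubes.FinNonempty.deg L R ∧
        EZCubes.IsEilenbergZilber.{w} EZCubes.FinNonempty.deg L R)) := by
  refine ⟨fun S hS => ?_, fun S hS => ?_, fun S hS => ?_⟩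
  · have h : EZCubes.IsSplitEilenbergZilber.{w} (EZCubes.Site.deg (S := S)) := by
      rcases hS with rfl | rfl <;>
        exact EZCubes.site_isSplitEilenbergZilber (by simp) (by simp) (by simp)
    exact ⟨_, _, h.isStronglySkeletal, h.isEilenbergZilber⟩
  · have h : ¬ IsIdempotentComplete (EZCubes.Site S) ∧
        ¬ ∃ R : MorphismProperty (Idempotents.Karoubi (EZCubes.Site S)),
          EZCubes.IsOrthogonalFactorizationSystem
            (EZCubes.splitEpis (Idempotents.Karoubi (EZCubes.Site S))) R := by
      rcases hS with rfl | rfl | rfl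
      · exact ⟨EZCubes.not_isIdempotentComplete_of_meet (by simp) (by simp),
          EZCubes.not_splitEpis_of_preserves (.inl ⟨rfl, rfl⟩) (by simp)
            (fun hf hg => hf.and (by simp) (by simp) hg)
            (fun hf => hf.apply_and (by simp) (by simp))⟩
      · exact ⟨EZCubes.not_isIdempotentComplete_of_join (by simp) (by simp),
          EZCubes.not_splitEpis_of_preserves (.inr ⟨rfl, rfl⟩) (by simp)
            (fun hf hg => hf.or (by simp) (by simp) hg)
            (fun hf => hf.apply_or (by simp) (by simp))⟩
      · exact ⟨EZCubes.not_isIdempotentComplete_of_meet (by simp) (by simp),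
          EZCubes.not_splitEpis_of_meet_of_join (by simp) (by simp) (by simp) (by simp)⟩
    exact ⟨h.1, EZCubes.not_exists_isGeneralizedReedy h.1, h.2,
      EZCubes.not_exists_isEilenbergZilber h.2⟩
  · have hd : EZCubes.Feature.diagonal ∈ S := by simp [hS]
    have hm : EZCubes.Feature.meetConnection ∈ S := by simp [hS]
    have hj : EZCubes.Feature.joinConnection ∈ S := by simp [hS]
    have hr : EZCubes.Feature.reversal ∈ S := by simp [hS]
    have hC := EZCubes.not_isIdempotentComplete_of_meet hd hm
    have := EZCubes.fixedPointFunctor_isEquivalence hd hm hj hr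
    let e := (EZCubes.fixedPointFunctor S).asEquivalence
    -- Essential smallness of finite nonempty sets is inherited from the small Karoubi envelope.
    have h := EZCubes.FinNonempty.isSplitEilenbergZilber.{w} (EssentiallySmall.mk' e.symm)
    have h' := h.of_equivalence e inferInstance
    exact ⟨hC, EZCubes.not_exists_isGeneralizedReedy hC,
      ⟨e, ⟨EZCubes.toKaroubiCompFixedPointFunctor S⟩, _, _, h'.isStronglySkeletal,
        h'.isEilenbergZilber⟩,
      _, _, h.isStronglySkeletal, h.isEilenbergZilber⟩
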